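/- Let $r\ge 1$, $\mathfrak g=sl_{r+1}(\mathbb C)$, with $\mathfrak h$ the diagonal and $\mathfrak n_+$ the strictly upper triangular matrices in $\mathfrak g$, simple coroots $h_i=E_{ii}-E_{i+1,i+1}$, weight lattice $P\subset\mathfrak h^*$ and fundamental weights $\omega_1,\dots,\omega_r$. Let $A$ be a commutative unital $\mathbb C$-algebra and $n\ge 0$. A $\mathfrak g\otimes A$-module $W$ is called integrable if there is a finite set $D\subset P$ with $W=\bigoplus_{\mu\in D}W^\mu$, where $h\otimes 1$ acts on $W^\mu$ by $\mu(h)$ for all $h\in\mathfrak h$. For $\lambda\in\mathfrak h^*$ the global Weyl module $W_A(\lambda)$ is the maximal integrable $\mathfrak g\otimes A$-module generated by a vector $v_\lambda$ such that $(\mathfrak n_+\otimes P)v_\lambda=0$ and $(h\otimes 1)v_\lambda=\lambda(h)v_\lambda$ for all $P\in A$, $h\in\mathfrak h$ (maximal: every other module with these properties is a quotient of it, by a map sending generator to generator). A point of $M$ is a $\mathbb C$-algebra homomorphism $A\to\mathbb C$ (equivalently, an ideal of codimension one), and $P(\mathcal Z)$ denotes the value of $P\in A$ at the point $\mathcal Z$.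 For a dominant weight $\lambda$ with $\lambda_i=\lambda(h_i)\in\mathbb Z_{\ge0}$, a $\lambda$-multiset $\{\mathcal Z\}_\lambda$ is a family of not necessarily distinct points $\mathcal Z^{(i)}_j$, $1\le i\le r$, $1\le j\le\lambda_i$. The local Weyl module $W_M(\{\mathcal Z\}_\lambda)$ is the maximal integrable $\mathfrak g\otimes A$-module generated by a vector $v_{\{\mathcal Z\}_\lambda}$ such that $(\mathfrak n_+\otimes P)v_{\{\mathcal Z\}_\lambda}=0$ and $(h_i\otimes P)v_{\{\mathcal Z\}_\lambda}=\sum_{j=1}^{\lambda_i}P(\mathcal Z^{(i)}_j)\,v_{\{\mathcal Z\}_\lambda}$ for all $i$ and $P\in A$. Let $V_{r+1}=\mathbb C^{r+1}$ be the vector representation with highest weight vector $v$, let $L_A(V_{r+1})=V_{r+1}\otimes A$ with the natural action of $\mathfrak g\otimes A$, let $S^n$ denote the $n$-th symmetric power over $\mathbb C$ (realized by symmetric tensors), and let $v^{(n)}=(v\otimes1)\otimes\dots\otimes(v\otimes1)\in S^n(L_A(V_{r+1}))$. The algebra $S^n(A)=(A^{\otimes n})^{\Sigma_n}$ acts on $S^n(L_A(V_{r+1}))$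 through the action of $A$ on each factor, and this action commutes with $\mathfrak g\otimes A$. For an $n\omega_1$-multiset let $J_{\{\mathcal Z\}_{n\omega_1}}=\{R\in S^n(A)\mid R(\mathcal Z^{(1)}_1,\dots,\mathcal Z^{(1)}_n)=0\}$. Theorem. (1) The global Weyl module $W_A(n\omega_1)$ exists, and there is an isomorphism of $\mathfrak g\otimes A$-modules $$W_A(n\omega_1)\cong S^n\left(L_A(V_{r+1})\right)$$ that sends $v_{n\omega_1}$ to $v^{(n)}$. (2) For every $n\omega_1$-multiset $\{\mathcal Z\}_{n\omega_1}$ the local Weyl module $W_M(\{\mathcal Z\}_{n\omega_1})$ exists, and there is an isomorphism of $\mathfrak g\otimes A$-modules $$W_M(\{\mathcal Z\}_{n\omega_1})\cong S^n\left(L_A(V_{r+1})\right)/J_{\{\mathcal Z\}_{n\omega_1}}\cdot S^n\left(L_A(V_{r+1})\right)$$ that sends $v_{\{\mathcal Z\}_{n\omega_1}}$ to the class of $v^{(n)}$. -/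

import Mathlib

open scoped TensorProduct

namespace WeylSym

/-! ### Cyclic modules of a Lie algebra as quotients of its enveloping algebra -/

section Cyclic

attribute [local instance] LieRing.ofAssociativeRing

/-- The cyclic `L`-module `U(L) / K` for a left ideal `K` of `U(L)`. -/
abbrev CyclicQuotient {L : Type*} [LieRing L] [LieAlgebra ℂ L]
    (K : Submodule (UniversalEnvelopingAlgebra ℂ L) (UniversalEnvelopingAlgebra ℂ L)) :=
  UniversalEnvelopingAlgebra ℂ L ⧸ K

variable {L : Type*} [LieRing L] [LieAlgebra ℂ L]
  (K : Submodule (UniversalEnvelopingAlgebra ℂ L) (UniversalEnvelopingAlgebra ℂ L))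

/-- `L` acts on `U(L) / K` by left multiplication. -/
noncomputable instance : LieRingModule L (CyclicQuotient K) where
  bracket x m := UniversalEnvelopingAlgebra.ι ℂ x • m
  add_lie x y m := by rw [map_add, add_smul]
  lie_add x m m' := smul_add _ _ _
  leibniz_lie x y m := by
    change _ • _ • m = UniversalEnvelopingAlgebra.ι ℂ ⁅x, y⁆ • m + _ • _ • m
    rw [LieHom.map_lie, LieRing.of_associative_ring_bracket, sub_smul, mul_smul, mul_smul,
      sub_add_cancel]

theorem cyclic_lie_def (x : L) (m : CyclicQuotient K) :
    ⁅x, m⁆ = UniversalEnvelopingAlgebra.ι ℂ x • m := rfl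

noncomputable instance : LieModule ℂ L (CyclicQuotient K) where
  smul_lie t x m := by rw [cyclic_lie_def, cyclic_lie_def, map_smul, smul_assoc]
  lie_smul t x m := by rw [cyclic_lie_def, cyclic_lie_def, smul_algebra_smul_comm]

/-- The generator of `U(L) / K`, the class of `1`. -/
noncomputable def CyclicQuotient.gen : CyclicQuotient K := Submodule.Quotient.mk 1

/-- Two cyclic quotients with `K ≤ K'`: the second one is a quotient of the first one. -/
theorem exists_factor {K K' : Submodule (UniversalEnvelopingAlgebra ℂ L)
      (UniversalEnvelopingAlgebra ℂ L)} (h : K ≤ K') :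
    ∃ φ : CyclicQuotient K →ₗ⁅ℂ, L⁆ CyclicQuotient K', Function.Surjective φ ∧
      φ (CyclicQuotient.gen K) = CyclicQuotient.gen K' := by
  let f := Submodule.mapQ K K' LinearMap.id h
  refine ⟨{ f.restrictScalars ℂ with map_lie' := fun {x m} => f.map_smul _ m }, ?_, rfl⟩
  intro y
  obtain ⟨u, rfl⟩ := Submodule.Quotient.mk_surjective _ y
  exact ⟨Submodule.Quotient.mk u, rfl⟩

/-- Every cyclic `L`-module is of the form `U(L) / K`. -/
theorem exists_equiv_cyclicQuotient {V : Type*} [AddCommGroup V] [Module ℂ V]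
    [LieRingModule L V] [LieModule ℂ L V] (v : V) (hv : LieSubmodule.lieSpan ℂ L {v} = ⊤) :
    ∃ (K : Submodule (UniversalEnvelopingAlgebra ℂ L) (UniversalEnvelopingAlgebra ℂ L))
      (e : CyclicQuotient K ≃ₗ⁅ℂ, L⁆ V), e (CyclicQuotient.gen K) = v := by
  let ρ := UniversalEnvelopingAlgebra.lift ℂ (LieModule.toEnd ℂ L V)
  have hρ : ∀ (x : L) (w : V), ρ (UniversalEnvelopingAlgebra.ι ℂ x) w = ⁅x, w⁆ := fun x w => by
    simp [ρ]
  let K : Submodule (UniversalEnvelopingAlgebra ℂ L) (UniversalEnvelopingAlgebra ℂ L) :=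
    { carrier := {u | ρ u v = 0}
      add_mem' := fun {a b} ha hb => by
        simp only [Set.mem_ofPred_eq] at ha hb ⊢
        rw [map_add, LinearMap.add_apply, ha, hb, add_zero]
      zero_mem' := by simp
      smul_mem' := fun c u hu => by
        simp only [Set.mem_ofPred_eq] at hu ⊢
        rw [smul_eq_mul, map_mul, Module.End.mul_apply, hu, map_zero] }
  let g : UniversalEnvelopingAlgebra ℂ L →ₗ[ℂ] V := (LinearMap.applyₗ v).comp ρ.toLinearMap
  have hg : ∀ u, g u = ρ u v := fun u => rfl
  have hK : K.restrictScalars ℂ = LinearMap.ker g := by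
    ext u; rfl
  have hgs : LinearMap.range g = ⊤ := by
    let N : LieSubmodule ℂ L V :=
      { LinearMap.range g with
        lie_mem := by
          rintro x _ ⟨u, rfl⟩
          refine ⟨UniversalEnvelopingAlgebra.ι ℂ x * u, ?_⟩
          rw [hg, hg, map_mul, Module.End.mul_apply, hρ] }
    have hN : N = ⊤ := by
      rw [eq_top_iff, ← hv, LieSubmodule.lieSpan_le, Set.singleton_subset_iff]
      exact ⟨1, by rw [hg, map_one]; rfl⟩
    rw [eq_top_iff]
    intro w _
    have : w ∈ N := by rw [hN]; trivial
    exact this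
  let f : CyclicQuotient K →ₗ[ℂ] V :=
    { toFun := Quotient.lift (fun u => g u) (fun a b hab => by
        have h1 : a - b ∈ K := (Submodule.quotientRel_def K).1 hab
        have h2 : g (a - b) = 0 := h1
        rw [map_sub, sub_eq_zero] at h2
        exact h2)
      map_add' := by
        rintro ⟨a⟩ ⟨b⟩
        exact g.map_add a b
      map_smul' := by
        rintro c ⟨a⟩
        exact g.map_smul c a }
  have hf : ∀ u, f (Submodule.Quotient.mk u) = ρ u v := fun u => rfl
  have hbij : Function.Bijective f := by
    constructor
    · rw [injective_iff_map_eq_zero]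
      intro m hm
      obtain ⟨u, rfl⟩ := Submodule.Quotient.mk_surjective _ m
      exact (Submodule.Quotient.mk_eq_zero K).2 hm
    · intro w
      have : w ∈ LinearMap.range g := by rw [hgs]; trivial
      obtain ⟨u, hu⟩ := this
      exact ⟨Submodule.Quotient.mk u, hu⟩
  let e := LinearEquiv.ofBijective f hbij
  refine ⟨K, { e with map_lie' := ?_ }, ?_⟩
  · intro x m
    obtain ⟨u, rfl⟩ := Submodule.Quotient.mk_surjective _ m
    change f (Submodule.Quotient.mk (UniversalEnvelopingAlgebra.ι ℂ x * u)) = ⁅x, f _⁆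
    rw [hf, hf, map_mul, Module.End.mul_apply, hρ]
  · change f (Submodule.Quotient.mk 1) = v
    rw [hf, map_one]; rfl

end Cyclic

/-! ### The Lie algebra `sl_{r+1} ⊗ A`, weights and integrability -/

/-- `sl_{r+1}` over `ℂ`; rows and columns are indexed by `0, …, r`. -/
abbrev SL (r : ℕ) := LieAlgebra.SpecialLinear.sl (Fin (r + 1)) ℂ

/-- The Lie algebra `sl_{r+1} ⊗ A` with `[a ⊗ x, b ⊗ y] = ab ⊗ [x, y]`. -/
abbrev Current (r : ℕ) (A : Type*) [CommRing A] [Algebra ℂ A] := A ⊗[ℂ] SL r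

/-- The Cartan subalgebra: diagonal matrices. -/
def cartan (r : ℕ) : Submodule ℂ (SL r) where
  carrier := {x | ∀ i j, i ≠ j → x.val i j = 0}
  add_mem' := fun {a b} ha hb i j h => by
    change a.val i j + b.val i j = 0
    rw [ha i j h, hb i j h, add_zero]
  zero_mem' := fun i j _ => rfl
  smul_mem' := fun c a ha i j h => by
    change c * a.val i j = 0
    rw [ha i j h, mul_zero]

/-- The subalgebra `n₊`: strictly upper triangular matrices. -/
def nPlus (r : ℕ) : Submodule ℂ (SL r) where
  carrier := {x | ∀ i j, j ≤ i → x.val i j = 0}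
  add_mem' := fun {a b} ha hb i j h => by
    change a.val i j + b.val i j = 0
    rw [ha i j h, hb i j h, add_zero]
  zero_mem' := fun i j _ => rfl
  smul_mem' := fun c a ha i j h => by
    change c * a.val i j = 0
    rw [ha i j h, mul_zero]

/-- The Chevalley generator `h_i = E_{i,i} - E_{i+1,i+1}` of the Cartan subalgebra. -/
noncomputable def coroot (r : ℕ) (i : Fin r) : cartan r :=
  ⟨LieAlgebra.SpecialLinear.singleSubSingle i.castSucc i.succ 1, fun a b h => by
    rw [LieAlgebra.SpecialLinear.val_singleSubSingle, Matrix.sub_apply, Matrix.single_apply,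
      Matrix.single_apply, if_neg (fun hh => h (hh.1.symm.trans hh.2)),
      if_neg (fun hh => h (hh.1.symm.trans hh.2)), sub_zero]⟩

/-- Weights: linear functionals on the Cartan subalgebra. -/
abbrev Weight (r : ℕ) := Module.Dual ℂ (cartan r)

/-- The fundamental weight `ω_i`: the sum of the first diagonal entries, through index `i`. -/
noncomputable def fundamentalWeight (r : ℕ) (i : Fin r) : Weight r where
  toFun h := ∑ j : Fin (r + 1), if j ≤ i.castSucc then h.val.val j j else 0
  map_add' a b := by
    rw [← Finset.sum_add_distrib]
    refine Finset.sum_congr rfl fun j _ => ?_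
    split_ifs
    · rfl
    · rw [add_zero]
  map_smul' c a := by
    rw [RingHom.id_apply, smul_eq_mul, Finset.mul_sum]
    refine Finset.sum_congr rfl fun j _ => ?_
    split_ifs
    · rfl
    · rw [mul_zero]

theorem fundamentalWeight_coroot (r : ℕ) (i j : Fin r) :
    fundamentalWeight r i (coroot r j) = if i = j then 1 else 0 := by
  have h : ∀ k : Fin (r + 1), (coroot r j).val.val k k =
      (if j.castSucc = k then 1 else 0) - (if j.succ = k then 1 else 0) := fun k => by
    change (LieAlgebra.SpecialLinear.singleSubSingle j.castSucc j.succ (1 : ℂ)).val k k = _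
    simp only [LieAlgebra.SpecialLinear.val_singleSubSingle, Matrix.sub_apply,
      Matrix.single_apply, and_self]
  change (∑ k : Fin (r + 1), if k ≤ i.castSucc then (coroot r j).val.val k k else 0) = _
  have h2 : ∀ k : Fin (r + 1), (if k ≤ i.castSucc then (coroot r j).val.val k k else 0) =
      (if j.castSucc = k then (if k ≤ i.castSucc then (1 : ℂ) else 0) else 0) -
      (if j.succ = k then (if k ≤ i.castSucc then (1 : ℂ) else 0) else 0) := fun k => by
    rw [h]; split_ifs <;> simp
  simp only [h2, Finset.sum_sub_distrib, Finset.sum_ite_eq, Finset.mem_univ, if_true]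
  have e1 : j.castSucc ≤ i.castSucc ↔ j.val ≤ i.val := Iff.rfl
  have e2 : j.succ ≤ i.castSucc ↔ j.val + 1 ≤ i.val := Iff.rfl
  have e3 : i = j ↔ i.val = j.val := Fin.ext_iff
  simp only [e1, e2, e3]
  split_ifs <;> first | omega | simp

/-- The weight lattice `P`. -/
def IsIntegral {r : ℕ} (μ : Weight r) : Prop := ∀ i : Fin r, ∃ m : ℤ, μ (coroot r i) = m

section Modules

variable {r : ℕ}

/-- The subspace `V^μ` on which every `h` in the Cartan subalgebra of `sl_{r+1} ⊗ 1` acts by the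
scalar `μ(h)`. -/
def weightSubspace (A : Type*) [CommRing A] [Algebra ℂ A] (V : Type*) [AddCommGroup V] [Module ℂ V]
    [LieRingModule (Current r A) V] [LieModule ℂ (Current r A) V] (μ : Weight r) : Submodule ℂ V where
  carrier := {v | ∀ h : cartan r, ⁅((1 : A) ⊗ₜ[ℂ] h.val : Current r A), v⁆ = μ h • v}
  add_mem' := fun {a b} ha hb h => by rw [lie_add, ha h, hb h, smul_add]
  zero_mem' := fun h => by rw [lie_zero, smul_zero]
  smul_mem' := fun c a ha h => by rw [lie_smul, ha h, smul_comm]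

open Classical in
/-- `V` is integrable over `sl_{r+1} ⊗ 1`: it is the direct sum of the weight subspaces `V^μ` for
`μ` in a finite set of integral weights. -/
def IsIntegrable (r : ℕ) (A : Type*) [CommRing A] [Algebra ℂ A] (V : Type*) [AddCommGroup V]
    [Module ℂ V] [LieRingModule (Current r A) V] [LieModule ℂ (Current r A) V] : Prop :=
  ∃ D : Finset (Weight r), (∀ μ ∈ D, IsIntegral μ) ∧
    DirectSum.IsInternal fun μ : D => weightSubspace A V μ.val

variable (A : Type*) [CommRing A] [Algebra ℂ A] {V : Type*} [AddCommGroup V] [Module ℂ V]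
  [LieRingModule (Current r A) V] [LieModule ℂ (Current r A) V]

/-- The property that defines the global Weyl module: `V` is integrable and generated by a vector
`v` with `(n₊ ⊗ P) v = 0` for `P ∈ A` and `(h ⊗ 1) v = lam(h) v`. -/
structure IsGlobalGenerator (lam : Weight r) (v : V) : Prop where
  integrable : IsIntegrable r A V
  generates : LieSubmodule.lieSpan ℂ (Current r A) {v} = ⊤
  nPlus_lie : ∀ (x : nPlus r) (P : A), ⁅(P ⊗ₜ[ℂ] x.val : Current r A), v⁆ = 0
  cartan_lie : ∀ h : cartan r, ⁅((1 : A) ⊗ₜ[ℂ] h.val : Current r A), v⁆ = lam h • v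

/-- Points of the affine variety (scheme) with algebra of functions `A`; the value of a function
`P` at the point `z` is `z P`. -/
abbrev Point (A : Type*) [CommRing A] [Algebra ℂ A] := A →ₐ[ℂ] ℂ

/-- A `lam`-multiset for the dominant weight with coordinates `lam i = lam(h_i)`: points
`Z i j` for `i = 1, …, r` and `j = 1, …, lam i`, not necessarily distinct. -/
abbrev WeightMultiset (A : Type*) [CommRing A] [Algebra ℂ A] {r : ℕ} (lam : Fin r → ℕ) :=
  (i : Fin r) → Fin (lam i) → Point A

/-- The property that defines the local Weyl module: `V` is integrable and generated by a vector
`v` with `(n₊ ⊗ P) v = 0` and `(h_i ⊗ P) v = ∑_j P(Z i j) v` for `P ∈ A`. -/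
structure IsLocalGenerator {A : Type*} [CommRing A] [Algebra ℂ A] {V : Type*} [AddCommGroup V]
    [Module ℂ V] [LieRingModule (Current r A) V] [LieModule ℂ (Current r A) V] {lam : Fin r → ℕ} (Z : WeightMultiset A lam) (v : V) : Prop where
  integrable : IsIntegrable r A V
  generates : LieSubmodule.lieSpan ℂ (Current r A) {v} = ⊤
  nPlus_lie : ∀ (x : nPlus r) (P : A), ⁅(P ⊗ₜ[ℂ] x.val : Current r A), v⁆ = 0
  coroot_lie : ∀ (i : Fin r) (P : A),
    ⁅(P ⊗ₜ[ℂ] (coroot r i).val : Current r A), v⁆ = (∑ j, Z i j P) • v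

end Modules

/-! ### Weyl modules -/

section WeylModules

variable {r : ℕ} (A : Type*) [CommRing A] [Algebra ℂ A]

/-- The least left ideal `K` among those for which `U / K` is a module as in the definition of the
global Weyl module. -/
noncomputable def globalWeylIdeal (lam : Weight r) :
    Submodule (UniversalEnvelopingAlgebra ℂ (Current r A))
      (UniversalEnvelopingAlgebra ℂ (Current r A)) :=
  sInf {K | IsGlobalGenerator A lam (CyclicQuotient.gen K)}

/-- The global Weyl module `W_A(lam)`. -/
abbrev GlobalWeyl (lam : Weight r) := CyclicQuotient (globalWeylIdeal A lam)

/-- The generator `v_lam` of `W_A(lam)`. -/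
noncomputable def globalWeylGen (lam : Weight r) : GlobalWeyl A lam := CyclicQuotient.gen _

variable {A}

/-- The least left ideal `K` among those for which `U / K` is a module as in the definition of the
local Weyl module. -/
noncomputable def localWeylIdeal {lam : Fin r → ℕ} (Z : WeightMultiset A lam) :
    Submodule (UniversalEnvelopingAlgebra ℂ (Current r A))
      (UniversalEnvelopingAlgebra ℂ (Current r A)) :=
  sInf {K | IsLocalGenerator Z (CyclicQuotient.gen K)}

/-- The local Weyl module of the multiset `Z`. -/
abbrev LocalWeyl {lam : Fin r → ℕ} (Z : WeightMultiset A lam) := CyclicQuotient (localWeylIdeal Z)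

/-- The generator of the local Weyl module. -/
noncomputable def localWeylGen {lam : Fin r → ℕ} (Z : WeightMultiset A lam) : LocalWeyl Z :=
  CyclicQuotient.gen _

section Transport

variable {V V' : Type*} [AddCommGroup V] [Module ℂ V] [LieRingModule (Current r A) V]
  [LieModule ℂ (Current r A) V] [AddCommGroup V'] [Module ℂ V'] [LieRingModule (Current r A) V']
  [LieModule ℂ (Current r A) V']

theorem IsIntegrable.of_equiv (e : V ≃ₗ⁅ℂ, Current r A⁆ V') (h : IsIntegrable r A V') :
    IsIntegrable r A V := by
  classical
  obtain ⟨D, hD, hi⟩ := h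
  refine ⟨D, hD, ?_⟩
  rw [DirectSum.isInternal_submodule_iff_iSupIndep_and_iSup_eq_top] at hi ⊢
  have key : ∀ μ : Weight r, weightSubspace A V μ =
      Submodule.orderIsoMapComap e.toLinearEquiv.symm (weightSubspace A V' μ) := by
    intro μ
    ext v
    have h1 : v ∈ Submodule.orderIsoMapComap e.toLinearEquiv.symm (weightSubspace A V' μ) ↔
        e v ∈ weightSubspace A V' μ := by
      rw [Submodule.orderIsoMapComap_apply]
      constructor
      · rintro ⟨w, hw, rfl⟩
        have : e (e.toLinearEquiv.symm w) = w := e.toLinearEquiv.apply_symm_apply w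
        change e (e.toLinearEquiv.symm w) ∈ _
        rw [this]; exact hw
      · intro hw
        exact ⟨e v, hw, e.toLinearEquiv.symm_apply_apply v⟩
    rw [h1]
    refine forall_congr' fun h => ?_
    have hs : μ h • e v = e (μ h • v) := (e.toLinearEquiv.map_smul _ _).symm
    have hl : ⁅((1 : A) ⊗ₜ[ℂ] h.val : Current r A), e v⁆ =
      e ⁅((1 : A) ⊗ₜ[ℂ] h.val : Current r A), v⁆ := (LieModuleHom.map_lie e.toLieModuleHom _ _).symm
    rw [hl, hs]
    exact (e.injective.eq_iff).symm
  simp only [key]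
  refine ⟨hi.1.map_orderIso _, ?_⟩
  rw [← OrderIso.map_iSup, hi.2, OrderIso.map_top]

theorem generates_of_equiv (e : V ≃ₗ⁅ℂ, Current r A⁆ V') {w : V} {v : V'} (he : e w = v)
    (hv : LieSubmodule.lieSpan ℂ (Current r A) {v} = ⊤) :
    LieSubmodule.lieSpan ℂ (Current r A) {w} = ⊤ := by
  rw [eq_top_iff]
  intro m _
  have hes : ∀ m : V, e.symm (e m) = m := e.toLinearEquiv.symm_apply_apply
  have h2 : (⊤ : LieSubmodule ℂ (Current r A) V') ≤
      (LieSubmodule.lieSpan ℂ (Current r A) {w}).comap e.symm.toLieModuleHom := by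
    rw [← hv, LieSubmodule.lieSpan_le, Set.singleton_subset_iff]
    change e.symm v ∈ LieSubmodule.lieSpan ℂ (Current r A) {w}
    rw [← he, hes]
    exact LieSubmodule.subset_lieSpan rfl
  have h3 := h2 (LieSubmodule.mem_top (e m))
  change e.symm (e m) ∈ LieSubmodule.lieSpan ℂ (Current r A) {w} at h3
  rwa [hes] at h3

/-- `W_A(lam)` is maximal: every module with the defining property is a quotient of it. -/
theorem globalWeyl_universal {lam : Weight r} {v : V}
    (hv : IsGlobalGenerator A lam v) :
    ∃ φ : GlobalWeyl A lam →ₗ⁅ℂ, Current r A⁆ V, Function.Surjective φ ∧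
      φ (globalWeylGen A lam) = v := by
  obtain ⟨K, e, he⟩ := exists_equiv_cyclicQuotient v hv.generates
  have hl : ∀ (x : Current r A) (w : CyclicQuotient K), e ⁅x, w⁆ = ⁅x, e w⁆ :=
    fun x w => LieModuleHom.map_lie e.toLieModuleHom x w
  have hs : ∀ (c : ℂ) (w : CyclicQuotient K), e (c • w) = c • e w :=
    fun c w => e.toLinearEquiv.map_smul c w
  have h0 : e 0 = 0 := e.toLinearEquiv.map_zero
  have hK : IsGlobalGenerator A lam (CyclicQuotient.gen K) := by
    refine ⟨hv.integrable.of_equiv e, ?_, fun x P => ?_, fun h => ?_⟩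
    · exact generates_of_equiv e he hv.generates
    · apply e.injective
      rw [hl, he, h0]; exact hv.nPlus_lie x P
    · apply e.injective
      rw [hl, he, hs, he]; exact hv.cartan_lie h
  obtain ⟨φ, hφ, hg⟩ := exists_factor (sInf_le hK : globalWeylIdeal A lam ≤ K)
  refine ⟨e.toLieModuleHom.comp φ, e.surjective.comp hφ, ?_⟩
  change e (φ (globalWeylGen A lam)) = v
  rw [← he]
  exact congrArg e hg

/-- The local Weyl module is maximal: every module with the defining property is a quotient. -/
theorem localWeyl_universal {lam : Fin r → ℕ} {Z : WeightMultiset A lam} {v : V}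
    (hv : IsLocalGenerator Z v) :
    ∃ φ : LocalWeyl Z →ₗ⁅ℂ, Current r A⁆ V, Function.Surjective φ ∧
      φ (localWeylGen Z) = v := by
  obtain ⟨K, e, he⟩ := exists_equiv_cyclicQuotient v hv.generates
  have hl : ∀ (x : Current r A) (w : CyclicQuotient K), e ⁅x, w⁆ = ⁅x, e w⁆ :=
    fun x w => LieModuleHom.map_lie e.toLieModuleHom x w
  have hs : ∀ (c : ℂ) (w : CyclicQuotient K), e (c • w) = c • e w :=
    fun c w => e.toLinearEquiv.map_smul c w
  have h0 : e 0 = 0 := e.toLinearEquiv.map_zero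
  have hK : IsLocalGenerator Z (CyclicQuotient.gen K) := by
    refine ⟨hv.integrable.of_equiv e, ?_, fun x P => ?_, fun i P => ?_⟩
    · exact generates_of_equiv e he hv.generates
    · apply e.injective
      rw [hl, he, h0]; exact hv.nPlus_lie x P
    · apply e.injective
      rw [hl, he, hs, he]; exact hv.coroot_lie i P
  obtain ⟨φ, hφ, hg⟩ := exists_factor (sInf_le hK : localWeylIdeal Z ≤ K)
  refine ⟨e.toLieModuleHom.comp φ, e.surjective.comp hφ, ?_⟩
  change e (φ (localWeylGen Z)) = v
  rw [← he]
  exact congrArg e hg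

end Transport

end WeylModules

/-! ### Symmetric powers -/

section SymmetricPowers

/-- The space of symmetric tensors in `M ⊗ ⋯ ⊗ M`. -/
def symTensors (n : ℕ) (M : Type*) [AddCommGroup M] [Module ℂ M] :
    Submodule ℂ (⨂[ℂ] _ : Fin n, M) where
  carrier := {t | ∀ σ : Equiv.Perm (Fin n), PiTensorProduct.reindex ℂ (fun _ => M) σ t = t}
  add_mem' := fun {a b} ha hb σ => by rw [map_add, ha σ, hb σ]
  zero_mem' := fun σ => map_zero _
  smul_mem' := fun c a ha σ => by rw [map_smul, ha σ]

/-- The symmetric power `S^n(M)`, realized (as usual in characteristic zero) as the space of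
symmetric tensors. -/
def SymPower (n : ℕ) (M : Type*) [AddCommGroup M] [Module ℂ M] : Type _ := symTensors n M

noncomputable instance (n : ℕ) (M : Type*) [AddCommGroup M] [Module ℂ M] :
    AddCommGroup (SymPower n M) := Submodule.addCommGroup (symTensors n M)

noncomputable instance (n : ℕ) (M : Type*) [AddCommGroup M] [Module ℂ M] :
    Module ℂ (SymPower n M) := Submodule.module (symTensors n M)

/-- The algebra `S^n(A)` of symmetric tensors in `A ⊗ ⋯ ⊗ A`, with factorwise multiplication. -/
noncomputable def SymAlgebra (n : ℕ) (A : Type*) [CommRing A] [Algebra ℂ A] :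
    Subalgebra ℂ (⨂[ℂ] _ : Fin n, A) where
  carrier := {t | ∀ σ : Equiv.Perm (Fin n), PiTensorProduct.reindex ℂ (fun _ => A) σ t = t}
  add_mem' := fun {a b} ha hb σ => by rw [map_add, ha σ, hb σ]
  mul_mem' := fun {a b} ha hb σ => by
    have h : ∀ a b : ⨂[ℂ] _ : Fin n, A, PiTensorProduct.reindex ℂ (fun _ => A) σ (a * b) =
        PiTensorProduct.reindex ℂ (fun _ => A) σ a *
          PiTensorProduct.reindex ℂ (fun _ => A) σ b := fun a b => by
      induction a using PiTensorProduct.induction_on with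
      | add x y hx hy => rw [add_mul, map_add, hx, hy, map_add, add_mul]
      | smul_tprod c x =>
        induction b using PiTensorProduct.induction_on with
        | add x y hx hy => rw [mul_add, map_add, hx, hy, map_add, mul_add]
        | smul_tprod d y =>
          rw [smul_mul_smul_comm, PiTensorProduct.tprod_mul_tprod]
          simp only [map_smul, PiTensorProduct.reindex_tprod]
          rw [smul_mul_smul_comm, PiTensorProduct.tprod_mul_tprod]
          rfl
    rw [h, ha σ, hb σ]
  algebraMap_mem' := fun c σ => by
    rw [Algebra.algebraMap_eq_smul_one, map_smul, PiTensorProduct.one_def,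
      PiTensorProduct.reindex_tprod]
    rfl

section LieAction

variable {L : Type*} [LieRing L] [LieAlgebra ℂ L] (n : ℕ) {M : Type*} [AddCommGroup M] [Module ℂ M]
  [LieRingModule L M] [LieModule ℂ L M]

/-- The action of `x ∈ L` on `M ⊗ ⋯ ⊗ M` by the Leibniz rule. -/
noncomputable def tensorAct (x : L) : Module.End ℂ (⨂[ℂ] _ : Fin n, M) :=
  ∑ i : Fin n, PiTensorProduct.map
    (Function.update (fun _ => LinearMap.id) i (LieModule.toEnd ℂ L M x))

theorem tensorAct_tprod (x : L) (m : Fin n → M) :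
    tensorAct n x (PiTensorProduct.tprod ℂ m) =
      ∑ i : Fin n, PiTensorProduct.tprod ℂ (Function.update m i ⁅x, m i⁆) := by
  rw [tensorAct, LinearMap.sum_apply]
  refine Finset.sum_congr rfl fun i _ => ?_
  rw [PiTensorProduct.map_tprod]
  congr 1
  funext j
  by_cases h : j = i
  · subst h; simp
  · simp [h]

theorem tensorAct_add (x y : L) : tensorAct (M := M) n (x + y) = tensorAct n x + tensorAct n y := by
  simp only [tensorAct, map_add, PiTensorProduct.map_update_add, Finset.sum_add_distrib]

theorem tensorAct_smul (c : ℂ) (x : L) : tensorAct (M := M) n (c • x) = c • tensorAct n x := by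
  simp only [tensorAct, map_smul, PiTensorProduct.map_update_smul, Finset.smul_sum]

theorem tensorAct_lie (x y : L) (t : ⨂[ℂ] _ : Fin n, M) :
    tensorAct n ⁅x, y⁆ t = tensorAct n x (tensorAct n y t) - tensorAct n y (tensorAct n x t) := by
  induction t using PiTensorProduct.induction_on with
  | add a b ha hb => simp only [map_add, ha, hb]; abel
  | smul_tprod c m =>
    simp only [map_smul, ← smul_sub]
    congr 1
    have key : ∀ x y : L, tensorAct n x (tensorAct n y (PiTensorProduct.tprod ℂ m)) =
        (∑ i : Fin n, PiTensorProduct.tprod ℂ (Function.update m i ⁅x, ⁅y, m i⁆⁆)) +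
        ∑ i : Fin n, ∑ j ∈ Finset.univ.erase i, PiTensorProduct.tprod ℂ
          (Function.update (Function.update m i ⁅y, m i⁆) j ⁅x, m j⁆) := fun x y => by
      rw [tensorAct_tprod, map_sum, ← Finset.sum_add_distrib]
      refine Finset.sum_congr rfl fun i _ => ?_
      rw [tensorAct_tprod, ← Finset.add_sum_erase _ _ (Finset.mem_univ i), Function.update_self,
        Function.update_idem]
      congr 1
      refine Finset.sum_congr rfl fun j hj => ?_
      rw [Function.update_of_ne (Finset.ne_of_mem_erase hj)]
    rw [key x y, key y x, tensorAct_tprod]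
    have hcomm : (∑ i : Fin n, ∑ j ∈ Finset.univ.erase i, PiTensorProduct.tprod ℂ
          (Function.update (Function.update m i ⁅y, m i⁆) j ⁅x, m j⁆)) =
        ∑ i : Fin n, ∑ j ∈ Finset.univ.erase i, PiTensorProduct.tprod ℂ
          (Function.update (Function.update m i ⁅x, m i⁆) j ⁅y, m j⁆) := by
      rw [Finset.sum_comm' (t' := Finset.univ) (s' := fun j => Finset.univ.erase j)
        (by intro a b; simp [eq_comm])]
      refine Finset.sum_congr rfl fun i _ => Finset.sum_congr rfl fun j hj => ?_
      rw [Function.update_comm (Finset.ne_of_mem_erase hj)]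
    rw [hcomm, add_sub_add_right_eq_sub, ← Finset.sum_sub_distrib]
    refine Finset.sum_congr rfl fun i _ => ?_
    rw [lie_lie, MultilinearMap.map_update_sub]

theorem tensorAct_reindex (x : L) (σ : Equiv.Perm (Fin n)) (t : ⨂[ℂ] _ : Fin n, M) :
    PiTensorProduct.reindex ℂ (fun _ => M) σ (tensorAct n x t) =
      tensorAct n x (PiTensorProduct.reindex ℂ (fun _ => M) σ t) := by
  induction t using PiTensorProduct.induction_on with
  | add a b ha hb => simp only [map_add, ha, hb]
  | smul_tprod c m =>
    simp only [map_smul, PiTensorProduct.reindex_tprod, tensorAct_tprod, map_sum]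
    congr 1
    refine Fintype.sum_equiv σ _ _ fun i => ?_
    congr 1
    funext j
    by_cases h : j = σ i
    · subst h; rw [Function.update_self, Equiv.symm_apply_apply, Function.update_self]
    · have : σ.symm j ≠ i := fun hh => h (by rw [← hh, Equiv.apply_symm_apply])
      simp [h, this]

noncomputable instance : LieRingModule L (SymPower n M) where
  bracket x t := ⟨tensorAct n x t.val, fun σ => by rw [tensorAct_reindex, t.property σ]⟩
  add_lie x y t := Subtype.ext (by
    change tensorAct n (x + y) t.val = tensorAct n x t.val + tensorAct n y t.val
    rw [tensorAct_add, LinearMap.add_apply])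
  lie_add x t u := Subtype.ext (map_add (tensorAct n x) t.val u.val)
  leibniz_lie x y t := Subtype.ext (by
    change tensorAct n x (tensorAct n y t.val) =
      tensorAct n ⁅x, y⁆ t.val + tensorAct n y (tensorAct n x t.val)
    rw [tensorAct_lie, sub_add_cancel])

theorem symPower_lie_val (x : L) (t : SymPower n M) : (⁅x, t⁆ : SymPower n M).val =
    tensorAct n x t.val := rfl

noncomputable instance : LieModule ℂ L (SymPower n M) where
  smul_lie c x t := Subtype.ext (by
    change tensorAct n (c • x) t.val = c • tensorAct n x t.val
    rw [tensorAct_smul, LinearMap.smul_apply])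
  lie_smul c x t := Subtype.ext (map_smul (tensorAct n x) c t.val)

end LieAction

section AlgebraAction

variable (n : ℕ) {A : Type*} [CommRing A] [Algebra ℂ A] {M : Type*} [AddCommGroup M] [Module ℂ M]
  [Module A M] [IsScalarTower ℂ A M]

/-- The factorwise action of `A ⊗ ⋯ ⊗ A` on `M ⊗ ⋯ ⊗ M` for an `A`-module `M`. -/
noncomputable def factorAct :
    (⨂[ℂ] _ : Fin n, A) →ₗ[ℂ] (⨂[ℂ] _ : Fin n, M) →ₗ[ℂ] ⨂[ℂ] _ : Fin n, M :=
  PiTensorProduct.map₂ fun _ => (Algebra.lsmul ℂ ℂ M : A →ₐ[ℂ] Module.End ℂ M).toLinearMap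

theorem factorAct_tprod (a : Fin n → A) (m : Fin n → M) :
    factorAct n (PiTensorProduct.tprod ℂ a) (PiTensorProduct.tprod ℂ m) =
      PiTensorProduct.tprod ℂ fun i => a i • m i := by
  rw [factorAct, PiTensorProduct.map₂_tprod_tprod]
  rfl

theorem factorAct_one (t : ⨂[ℂ] _ : Fin n, M) :
    factorAct n (1 : ⨂[ℂ] _ : Fin n, A) t = t := by
  induction t using PiTensorProduct.induction_on with
  | add a b ha hb => simp only [map_add, ha, hb]
  | smul_tprod c m =>
    rw [map_smul, PiTensorProduct.one_def, factorAct_tprod]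
    simp only [Pi.one_apply, one_smul]

theorem factorAct_mul (a b : ⨂[ℂ] _ : Fin n, A) (t : ⨂[ℂ] _ : Fin n, M) :
    factorAct n (a * b) t = factorAct n a (factorAct n b t) := by
  induction t using PiTensorProduct.induction_on with
  | add x y hx hy => simp only [map_add, hx, hy]
  | smul_tprod c m =>
    induction a using PiTensorProduct.induction_on with
    | add x y hx hy => simp only [add_mul, map_add, LinearMap.add_apply, hx, hy]
    | smul_tprod d a =>
      induction b using PiTensorProduct.induction_on with
      | add x y hx hy => simp only [mul_add, map_add, LinearMap.add_apply, hx, hy]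
      | smul_tprod d' b =>
        rw [smul_mul_smul_comm, PiTensorProduct.tprod_mul_tprod]
        simp only [map_smul, LinearMap.smul_apply, factorAct_tprod, Pi.mul_apply, mul_smul]
        rw [smul_comm d d']

theorem factorAct_reindex (σ : Equiv.Perm (Fin n)) (a : ⨂[ℂ] _ : Fin n, A)
    (t : ⨂[ℂ] _ : Fin n, M) :
    PiTensorProduct.reindex ℂ (fun _ => M) σ (factorAct n a t) =
      factorAct n (PiTensorProduct.reindex ℂ (fun _ => A) σ a)
        (PiTensorProduct.reindex ℂ (fun _ => M) σ t) := by
  induction t using PiTensorProduct.induction_on with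
  | add x y hx hy => simp only [map_add, hx, hy]
  | smul_tprod c m =>
    induction a using PiTensorProduct.induction_on with
    | add x y hx hy => simp only [map_add, LinearMap.add_apply, hx, hy]
    | smul_tprod d a =>
      simp only [map_smul, LinearMap.smul_apply, factorAct_tprod, PiTensorProduct.reindex_tprod]

/-- `S^n(A)` acts on `S^n(M)`. -/
noncomputable instance : Module (SymAlgebra n A) (SymPower n M) where
  smul R t := ⟨factorAct n R.val t.val, fun σ => by
    rw [factorAct_reindex, R.property σ, t.property σ]⟩
  one_smul t := Subtype.ext (factorAct_one n t.val)
  mul_smul R S t := Subtype.ext (factorAct_mul n R.val S.val t.val)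
  smul_zero R := Subtype.ext (map_zero (factorAct n R.val))
  smul_add R t u := Subtype.ext (map_add (factorAct n R.val) t.val u.val)
  add_smul R S t := Subtype.ext (by
    change factorAct n (R.val + S.val) t.val = factorAct n R.val t.val + factorAct n S.val t.val
    rw [map_add, LinearMap.add_apply])
  zero_smul t := Subtype.ext (by
    change factorAct n (0 : ⨂[ℂ] _ : Fin n, A) t.val = 0
    rw [map_zero, LinearMap.zero_apply])

theorem symPower_smul_val (R : SymAlgebra n A) (t : SymPower n M) :
    (R • t : SymPower n M).val = factorAct n R.val t.val := rfl

instance : IsScalarTower ℂ (SymAlgebra n A) (SymPower n M) where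
  smul_assoc c R t := Subtype.ext (by
    change factorAct n (c • R.val) t.val = c • factorAct n R.val t.val
    rw [map_smul, LinearMap.smul_apply])

/-- Evaluation of `R ∈ A ⊗ ⋯ ⊗ A` (a function of `n` points) at the points `z_1, …, z_n`. -/
noncomputable def evalAt (z : Fin n → Point A) : (⨂[ℂ] _ : Fin n, A) →ₐ[ℂ] ℂ :=
  PiTensorProduct.liftAlgHom
    ((MultilinearMap.mkPiAlgebra ℂ (Fin n) ℂ).compLinearMap fun i => (z i).toLinearMap)
    (by simp) (fun x y => by simp [Finset.prod_mul_distrib])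

theorem evalAt_tprod (z : Fin n → Point A) (a : Fin n → A) :
    evalAt n z (PiTensorProduct.tprod ℂ a) = ∏ i, z i (a i) := by
  change PiTensorProduct.lift _ (PiTensorProduct.tprod ℂ a) = _
  rw [PiTensorProduct.lift.tprod]
  simp

/-- The ideal of all `R ∈ S^n(A)` with `R(z_1, …, z_n) = 0`. -/
noncomputable def vanishingIdeal (z : Fin n → Point A) : Ideal (SymAlgebra n A) :=
  RingHom.ker ((evalAt n z).comp (SymAlgebra n A).val)

end AlgebraAction

end SymmetricPowers

/-! ### The modules `S^n(L_A(V_{r+1}))` -/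

section VectorRepresentation

variable (r : ℕ) (A : Type*) [CommRing A] [Algebra ℂ A]

/-- `L_A(V_{r+1}) = V_{r+1} ⊗ A` for the vector representation `V_{r+1} = ℂ^{r+1}`, with
`(a ⊗ x)(b ⊗ v) = ab ⊗ xv`. -/
abbrev LoopV := A ⊗[ℂ] (Fin (r + 1) → ℂ)

theorem loopV_lie_tmul (a b : A) (x : SL r) (v : Fin (r + 1) → ℂ) :
    ⁅(a ⊗ₜ[ℂ] x : Current r A), (b ⊗ₜ[ℂ] v : LoopV r A)⁆ = (a * b) ⊗ₜ[ℂ] (x.val.mulVec v) := rfl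

instance : LieModule ℂ (Current r A) (LoopV r A) where
  smul_lie c x m := by
    rw [← algebraMap_smul A c x, smul_lie, algebraMap_smul]
  lie_smul c x m := by
    rw [← algebraMap_smul A c m, lie_smul, algebraMap_smul]

/-- The vector `v^{(n)} = (v ⊗ 1) ⊗ ⋯ ⊗ (v ⊗ 1)` for the highest weight vector `v` of `V_{r+1}`. -/
noncomputable def highestVector (n : ℕ) : SymPower n (LoopV r A) :=
  ⟨PiTensorProduct.tprod ℂ fun _ => (1 : A) ⊗ₜ[ℂ] Pi.single 0 1, fun σ => by
    rw [PiTensorProduct.reindex_tprod]⟩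

variable {A}

theorem lie_smul_symAlgebra (n : ℕ) (x : Current r A) (R : SymAlgebra n A)
    (t : SymPower n (LoopV r A)) : ⁅x, R • t⁆ = R • ⁅x, t⁆ := by
  have h : ∀ (a : ⨂[ℂ] _ : Fin n, A) (u : ⨂[ℂ] _ : Fin n, LoopV r A),
      tensorAct n x (factorAct n a u) = factorAct n a (tensorAct n x u) := fun a u => by
    induction u using PiTensorProduct.induction_on with
    | add p q hp hq => simp only [map_add, hp, hq]
    | smul_tprod c m =>
      induction a using PiTensorProduct.induction_on with
      | add p q hp hq => simp only [map_add, LinearMap.add_apply, hp, hq]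
      | smul_tprod d a =>
        simp only [map_smul, LinearMap.smul_apply, factorAct_tprod, tensorAct_tprod, map_sum]
        congr 1
        rw [Finset.smul_sum]
        refine Finset.sum_congr rfl fun i _ => ?_
        congr 2
        funext j
        by_cases h : j = i
        · subst h; simp only [Function.update_self, lie_smul]
        · simp only [Function.update_of_ne h]
  exact Subtype.ext (h R.val t.val)

/-- The submodule `J · S^n(L_A(V_{r+1}))` for an ideal `J` of `S^n(A)`. -/
noncomputable def idealSubmodule (n : ℕ) (J : Ideal (SymAlgebra n A)) :
    LieSubmodule ℂ (Current r A) (SymPower n (LoopV r A)) where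
  toSubmodule := (J • (⊤ : Submodule (SymAlgebra n A) (SymPower n (LoopV r A)))).restrictScalars ℂ
  lie_mem := fun {x t} ht => by
    change t ∈ J • (⊤ : Submodule (SymAlgebra n A) (SymPower n (LoopV r A))) at ht
    change ⁅x, t⁆ ∈ J • (⊤ : Submodule (SymAlgebra n A) (SymPower n (LoopV r A)))
    induction ht using Submodule.smul_induction_on' with
    | smul R hR u hu =>
      rw [lie_smul_symAlgebra]
      exact Submodule.smul_mem_smul hR trivial
    | add p hp q hq ihp ihq =>
      rw [lie_add]
      exact add_mem ihp ihq

end VectorRepresentation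

/-- The coordinates of `n ω_1`. -/
def nOmegaOne (r : ℕ) [NeZero r] (n : ℕ) : Fin r → ℕ := Pi.single 0 n

/-- The points `Z^{(1)}_1, …, Z^{(1)}_n` of an `n ω_1`-multiset. -/
def firstPoints {A : Type*} [CommRing A] [Algebra ℂ A] {r : ℕ} [NeZero r] {n : ℕ}
    (Z : WeightMultiset A (nOmegaOne r n)) : Fin n → Point A :=
  fun j => Z 0 (Fin.cast (Pi.single_eq_same (M := fun _ : Fin r => ℕ) 0 n).symm j)

/-- The ideal `J_Z = {R ∈ S^n(A) | R(Z^{(1)}_1, …, Z^{(1)}_n) = 0}`. -/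
noncomputable def multisetIdeal {A : Type*} [CommRing A] [Algebra ℂ A] {r : ℕ} [NeZero r] {n : ℕ}
    (Z : WeightMultiset A (nOmegaOne r n)) : Ideal (SymAlgebra n A) :=
  vanishingIdeal n (firstPoints Z)

end WeylSym

open WeylSym

/-! The module `S^n(V ⊗ A)` is integrable, it is generated by `v^{(n)}`, and `v^{(n)}` satisfies the
highest weight relations. It remains to show that it is the largest such module: any highest weight
vector `u` of weight `n ω₁` in an integrable module `W` must be the image of `v^{(n)}` under a
homomorphism (`exists_symPower_hom`). By `exists_equiv_sInf` this maximality identifies it with the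
quotient of the enveloping algebra by the least admissible left ideal.

Integrability and `sl₂`-theory give two facts about `u`: matrices with zero first column kill it
(`lie_highest_eq_zero`), and `E_{21}^{n+1} u = 0` (`pow_lie_highest_eq_zero`). Hence the action of a
matrix on `u` depends only on its first column, an element of `M = V ⊗ A`. To have all of `M`
available as first columns, `sl ⊗ A` is enlarged to `gl ⊗ A`. The scalar `a ⊗ 1` should act on `u`
as `h₁ ⊗ a`, which need not extend to an operator on `W`. The enlarged algebra therefore acts on the
maps from the space of highest weight vectors to `W`, and the inclusion of that space takes the
place of `u` (`homAct`).

The homomorphism comes from normally ordered products. For `A = ℂ`, the model is `W = S^n(M)` with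
`m₀ = v` and `u = m₀^n`: the first column `m` acts as `m∂`, where `∂` is the derivation with `∂m = `
(the coordinate of `m` along `m₀`), and the ordered product is `m₁ ⋯ m_k ∂^k u`. These expressions
are symmetric in the `mᵢ` (`orderedProduct_comp_perm`). Acting by `x` produces the Leibniz terms and
one term with `k + 1` factors (`act_orderedProduct`). Products of `n + 1` factors vanish
(`orderedProduct_eq_zero`), as `∂^{n+1} m₀^n = 0` in the model, so products of `n` factors transform
exactly like `M^{⊗n}`. For `m₁ = ⋯ = m_n = m₀` the value is `n! u`, and division by `n!` finishes
the construction.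

For the local module, `h₁ ⊗ a` acts on `v^{(n)}` as the power sum of `a`. Power sums generate
`S^n(A)`, so prescribing the eigenvalues of all `h₁ ⊗ a` makes each `R ∈ S^n(A)` act on the
generator by its value at the given points. The homomorphism above therefore kills `J · S^n(V ⊗ A)`.
-/

namespace WeylSym

/-! ### Polarization: generating symmetric tensors from one power. -/

section Generation

variable {M V : Type*} [AddCommGroup M] [Module ℂ M] [AddCommGroup V] [Module ℂ V]

/-- If a symmetric multilinear map takes the constant family `m₀` into a subspace `Y`, and `Y` is
stable under the derivations induced by a set `G` of operators for which the vectors `g m₀` span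
everything, then the map takes all its values in `Y`. -/
theorem multilinear_mem_of_const_mem {n : ℕ} (F : MultilinearMap ℂ (fun _ : Fin n => M) V)
    (hF : ∀ (σ : Equiv.Perm (Fin n)) (m : Fin n → M), F (m ∘ σ) = F m) (Y : Submodule ℂ V) (m₀ : M)
    (h₀ : F (fun _ => m₀) ∈ Y) (G : Set (Module.End ℂ M))
    (hG : Submodule.span ℂ ((fun g => g m₀) '' G) = ⊤)
    (hY : ∀ g ∈ G, ∀ m : Fin n → M, F m ∈ Y →
      ∑ i, F (Function.update m i (g (m i))) ∈ Y) (m : Fin n → M) : F m ∈ Y := by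
  -- Induction on the set of positions at which `m` may differ from `m₀`.
  have key : ∀ (s : Finset (Fin n)) (m : Fin n → M), (∀ i ∉ s, m i = m₀) → F m ∈ Y := by
    intro s
    induction s using Finset.induction_on with
    | empty =>
      intro m hm
      rwa [show m = fun _ => m₀ from funext fun i => hm i (Finset.notMem_empty i)]
    | insert j s hj ih =>
      intro m hm
      suffices h : ∀ u : M, F (Function.update m j u) ∈ Y by
        simpa using h (m j)
      intro u
      have hu : u ∈ Submodule.span ℂ ((fun g : Module.End ℂ M => g m₀) '' G) := by
        rw [hG]; trivial
      induction hu using Submodule.span_induction with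
      | zero => rw [F.map_update_zero]; exact Y.zero_mem
      | add a b _ _ ha hb => rw [F.map_update_add]; exact Y.add_mem ha hb
      | smul c a _ ha => rw [F.map_update_smul]; exact Y.smul_mem c ha
      | mem u hu =>
        obtain ⟨g, hg, rfl⟩ := hu
        let m' := Function.update m j m₀
        have hm' : ∀ i ∉ s, m' i = m₀ := fun i hi => by
          by_cases hij : i = j
          · subst hij; simp [m']
          · simp only [m', Function.update_of_ne hij]
            exact hm i (by simp [hij, hi])
        -- The derivation of `g` is applied with `m₀` still in position `j`. Terms with `i ∈ s` are
        -- covered by induction. For each `i ∉ s` the term has one entry `g m₀` in a slot that held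
        -- `m₀`, so by symmetry it equals the wanted value. There is at least one such `i`, namely
        -- `j`, and characteristic zero allows division by their number.
        have h1 := hY g hg m' (ih m' hm')
        have h2 : ∑ i ∈ s, F (Function.update m' i (g (m' i))) ∈ Y :=
          Y.sum_mem fun i hi => ih _ fun k hk => by
            rw [Function.update_of_ne (ne_of_mem_of_not_mem hi hk).symm, hm' k hk]
        have h3 : ∀ i ∈ sᶜ, F (Function.update m' i (g (m' i))) =
            F (Function.update m j (g m₀)) := fun i hi => by
          have hi' : i ∉ s := Finset.mem_compl.1 hi
          rw [hm' i hi', ← hF (Equiv.swap i j)]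
          congr 1
          funext k
          simp only [Function.comp_apply]
          by_cases hk : k = j
          · subst hk; simp
          · by_cases hki : k = i
            · subst hki
              rw [Equiv.swap_apply_left, Function.update_of_ne hk, Function.update_of_ne (Ne.symm hk),
                hm' j hj, hm k (by simp [hk, hi'])]
            · rw [Equiv.swap_apply_of_ne_of_ne hki hk, Function.update_of_ne hki,
                Function.update_of_ne hk]
              simp [m', hk]
        have h4 : (sᶜ.card : ℂ) • F (Function.update m j (g m₀)) ∈ Y := by
          rw [← Finset.sum_add_sum_compl s, Finset.sum_congr rfl h3, Finset.sum_const,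
            ← Nat.cast_smul_eq_nsmul ℂ] at h1
          exact (Submodule.add_mem_iff_right Y h2).1 h1
        have hc : (sᶜ.card : ℂ) ≠ 0 := by
          rw [Nat.cast_ne_zero]
          exact Finset.card_ne_zero_of_mem (Finset.mem_compl.2 hj)
        exact (Submodule.smul_mem_iff Y hc).1 h4
  exact key Finset.univ m fun i hi => absurd (Finset.mem_univ i) hi

/-- Symmetrization of tensors. -/
noncomputable def symmetrize (n : ℕ) (M : Type*) [AddCommGroup M] [Module ℂ M] :
    (⨂[ℂ] _ : Fin n, M) →ₗ[ℂ] SymPower n M where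
  toFun t := ⟨∑ σ : Equiv.Perm (Fin n), PiTensorProduct.reindex ℂ (fun _ => M) σ t, fun τ => by
    rw [map_sum]
    refine Fintype.sum_equiv (Equiv.mulLeft τ) _ _ fun σ => ?_
    exact PiTensorProduct.reindex_reindex σ τ t⟩
  map_add' t u := Subtype.ext (by
    change ∑ σ, _ = (∑ σ, _) + ∑ σ, _
    simp only [map_add, Finset.sum_add_distrib])
  map_smul' c t := Subtype.ext (by
    change ∑ σ, _ = c • ∑ σ, _
    simp only [map_smul, Finset.smul_sum])

theorem symmetrize_val (n : ℕ) (t : ⨂[ℂ] _ : Fin n, M) : (symmetrize n M t).val =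
    ∑ σ : Equiv.Perm (Fin n), PiTensorProduct.reindex ℂ (fun _ => M) σ t := rfl

theorem symmetrize_symPower {n : ℕ} (t : SymPower n M) :
    symmetrize n M t.val = (n.factorial : ℂ) • t := by
  refine Subtype.ext ?_
  rw [symmetrize_val, Finset.sum_congr rfl fun σ _ => t.property σ, Finset.sum_const,
    Finset.card_univ, Fintype.card_perm, Fintype.card_fin, ← Nat.cast_smul_eq_nsmul ℂ]
  rfl

theorem symPower_eq_symmetrize {n : ℕ} (t : SymPower n M) :
    t = (n.factorial : ℂ)⁻¹ • symmetrize n M t.val := by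
  rw [symmetrize_symPower, inv_smul_smul₀ (Nat.cast_ne_zero.2 n.factorial_ne_zero)]

theorem symmetrize_tprod_comp {n : ℕ} (σ : Equiv.Perm (Fin n)) (m : Fin n → M) :
    symmetrize n M (PiTensorProduct.tprod ℂ (m ∘ σ)) =
      symmetrize n M (PiTensorProduct.tprod ℂ m) := by
  refine Subtype.ext ?_
  rw [symmetrize_val, symmetrize_val]
  refine Fintype.sum_equiv (Equiv.mulRight σ⁻¹) _ _ fun τ => ?_
  rw [PiTensorProduct.reindex_tprod, PiTensorProduct.reindex_tprod]
  congr 1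

/-- Dividing by `n!` makes symmetrization a projection, so symmetrized pure tensors span the
symmetric tensors. -/
theorem symmetrize_mem {n : ℕ} (Y : Submodule ℂ (SymPower n M))
    (h : ∀ m, symmetrize n M (PiTensorProduct.tprod ℂ m) ∈ Y) (t : SymPower n M) : t ∈ Y := by
  rw [symPower_eq_symmetrize t]
  refine Y.smul_mem _ ?_
  generalize t.val = u
  induction u using PiTensorProduct.induction_on with
  | add x y hx hy => rw [map_add]; exact Y.add_mem hx hy
  | smul_tprod c m => rw [map_smul]; exact Y.smul_mem c (h m)

theorem lie_symmetrize {L : Type*} [LieRing L] [LieAlgebra ℂ L] [LieRingModule L M]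
    [LieModule ℂ L M] {n : ℕ} (x : L) (t : ⨂[ℂ] _ : Fin n, M) :
    ⁅x, symmetrize n M t⁆ = symmetrize n M (tensorAct n x t) := by
  refine Subtype.ext ?_
  rw [symPower_lie_val, symmetrize_val, symmetrize_val, map_sum]
  exact Finset.sum_congr rfl fun σ _ => (tensorAct_reindex n x σ t).symm

/-- A power `m₀ ⊗ ⋯ ⊗ m₀` as a symmetric tensor. -/
noncomputable def symPow (n : ℕ) (m₀ : M) : SymPower n M :=
  ⟨PiTensorProduct.tprod ℂ fun _ => m₀, fun σ => by rw [PiTensorProduct.reindex_tprod]⟩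

/-- A subspace of `S^n(M)` that contains `m₀ ⊗ ⋯ ⊗ m₀` and is stable under a Lie algebra `L` with
`L m₀ = M` is everything. -/
theorem symPower_mem_of_lie_mem {L : Type*} [LieRing L] [LieAlgebra ℂ L] [LieRingModule L M]
    [LieModule ℂ L M] {n : ℕ} (Y : Submodule ℂ (SymPower n M)) (m₀ : M) (h₀ : symPow n m₀ ∈ Y)
    (hL : Submodule.span ℂ (Set.range fun x : L => ⁅x, m₀⁆) = ⊤)
    (hY : ∀ (x : L), ∀ t ∈ Y, ⁅x, t⁆ ∈ Y) (t : SymPower n M) : t ∈ Y := by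
  refine symmetrize_mem Y (fun m => ?_) t
  refine multilinear_mem_of_const_mem
    ((symmetrize n M).compMultilinearMap (PiTensorProduct.tprod ℂ))
    (fun σ m => symmetrize_tprod_comp σ m) Y m₀ ?_ (Set.range (LieModule.toEnd ℂ L M)) ?_ ?_ m
  · have := symmetrize_symPower (symPow n m₀)
    change symmetrize n M (symPow n m₀).val ∈ Y
    rw [this]
    exact Y.smul_mem _ h₀
  · rw [← Set.range_comp]
    exact hL
  · rintro _ ⟨x, rfl⟩ m hm
    have := hY x _ hm
    rw [LinearMap.compMultilinearMap_apply, lie_symmetrize, tensorAct_tprod, map_sum] at this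
    exact this

end Generation

/-! ### Power sums generate the symmetric tensors of an algebra. -/

section PowerSums

variable (n : ℕ) {A : Type*} [CommRing A] [Algebra ℂ A]

/-- The power sum `∑ᵢ 1 ⊗ ⋯ ⊗ a ⊗ ⋯ ⊗ 1`. -/
noncomputable def powerSum (a : A) : SymAlgebra n A :=
  ⟨∑ i : Fin n, PiTensorProduct.tprod ℂ (Function.update (1 : Fin n → A) i a), fun σ => by
    rw [map_sum]
    refine Fintype.sum_equiv σ _ _ fun i => ?_
    rw [PiTensorProduct.reindex_tprod]
    congr 1
    funext j
    by_cases h : j = σ i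
    · subst h; simp
    · have : σ.symm j ≠ i := fun hh => h (by rw [← hh, Equiv.apply_symm_apply])
      simp [h, this]⟩

theorem powerSum_mul_tprod (a : A) (b : Fin n → A) :
    (powerSum n a).val * PiTensorProduct.tprod ℂ b =
      ∑ i, PiTensorProduct.tprod ℂ (Function.update b i (a * b i)) := by
  change (∑ i : Fin n, PiTensorProduct.tprod ℂ (Function.update (1 : Fin n → A) i a)) * _ = _
  rw [Finset.sum_mul]
  refine Finset.sum_congr rfl fun i _ => ?_
  rw [PiTensorProduct.tprod_mul_tprod]
  congr 1
  funext j
  by_cases h : j = i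
  · subst h; simp
  · simp [h]

theorem powerSum_mul_reindex (a : A) (σ : Equiv.Perm (Fin n)) (t : ⨂[ℂ] _ : Fin n, A) :
    PiTensorProduct.reindex ℂ (fun _ => A) σ ((powerSum n a).val * t) =
      (powerSum n a).val * PiTensorProduct.reindex ℂ (fun _ => A) σ t := by
  induction t using PiTensorProduct.induction_on with
  | add x y hx hy => simp only [mul_add, map_add, hx, hy]
  | smul_tprod c b =>
    rw [mul_smul_comm, map_smul, map_smul, mul_smul_comm, PiTensorProduct.reindex_tprod,
      powerSum_mul_tprod, powerSum_mul_tprod, map_sum]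
    congr 1
    refine Fintype.sum_equiv σ _ _ fun i => ?_
    rw [PiTensorProduct.reindex_tprod]
    congr 1
    funext j
    by_cases h : j = σ i
    · subst h; rw [Function.update_self, Equiv.symm_apply_apply, Function.update_self]
    · have : σ.symm j ≠ i := fun hh => h (by rw [← hh, Equiv.apply_symm_apply])
      simp [h, this]

/-- In characteristic zero the power sums generate the algebra of symmetric tensors. -/
theorem symAlgebra_mem_of_powerSum_mul_mem (Y : Submodule ℂ (SymAlgebra n A)) (h₁ : 1 ∈ Y)
    (hY : ∀ (a : A), ∀ t ∈ Y, powerSum n a * t ∈ Y) (t : SymAlgebra n A) : t ∈ Y := by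
  -- `SymAlgebra n A` and `SymPower n A` have the same underlying tensors. Multiplication by a power
  -- sum is the derivation induced by multiplication by `a`, and the operators of multiplication
  -- send `1` to every element of `A`, so polarization applies with `m₀ = 1`.
  let Y' : Submodule ℂ (SymPower n A) :=
    { carrier := {u | (⟨u.val, u.property⟩ : SymAlgebra n A) ∈ Y}
      add_mem' := fun ha hb => Y.add_mem ha hb
      zero_mem' := Y.zero_mem
      smul_mem' := fun c _ ha => Y.smul_mem c ha }
  suffices h : (⟨t.val, t.property⟩ : SymPower n A) ∈ Y' from h
  refine symmetrize_mem Y' (fun m => ?_) _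
  refine multilinear_mem_of_const_mem
    ((symmetrize n A).compMultilinearMap (PiTensorProduct.tprod ℂ))
    (fun σ m => symmetrize_tprod_comp σ m) Y' 1 ?_ (Set.range (Algebra.lmul ℂ A)) ?_ ?_ m
  · have := symmetrize_symPower (symPow n (1 : A))
    change symmetrize n A (symPow n (1 : A)).val ∈ Y'
    rw [this]
    refine Y'.smul_mem _ ?_
    exact h₁
  · rw [← Set.range_comp, eq_top_iff]
    intro a _
    exact Submodule.subset_span ⟨a, by simp⟩
  · rintro _ ⟨a, rfl⟩ m hm
    have h2 : powerSum n a * ⟨(symmetrize n A (PiTensorProduct.tprod ℂ m)).val,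
        (symmetrize n A (PiTensorProduct.tprod ℂ m)).property⟩ ∈ Y := hY a _ hm
    have h3 : (⟨(∑ i, symmetrize n A (PiTensorProduct.tprod ℂ (Function.update m i (a * m i)))).val,
        (∑ i, symmetrize n A (PiTensorProduct.tprod ℂ
          (Function.update m i (a * m i)))).property⟩ : SymAlgebra n A) =
        powerSum n a * ⟨(symmetrize n A (PiTensorProduct.tprod ℂ m)).val,
          (symmetrize n A (PiTensorProduct.tprod ℂ m)).property⟩ := by
      rw [← map_sum, ← powerSum_mul_tprod]
      refine Subtype.ext ?_
      change ∑ σ, _ = (powerSum n a).val * ∑ σ, _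
      rw [Finset.mul_sum]
      exact Finset.sum_congr rfl fun σ _ => powerSum_mul_reindex n a σ _
    rw [← h3] at h2
    exact h2

end PowerSums


/-! ### Normally ordered products and the equivariant map they define. -/

section OrderedProducts

attribute [local instance 100] LieRing.ofAssociativeRing

variable {M : Type*} [AddCommGroup M] [Module ℂ M]

/-- The map `t ↦ m ⊗ t`. -/
noncomputable def consTensor (k : ℕ) (m : M) :
    (⨂[ℂ] _ : Fin k, M) →ₗ[ℂ] ⨂[ℂ] _ : Fin (k + 1), M :=
  PiTensorProduct.lift ((PiTensorProduct.tprod ℂ (s := fun _ : Fin (k + 1) => M)).curryLeft m)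

theorem consTensor_tprod {k : ℕ} (m : M) (f : Fin k → M) :
    consTensor k m (PiTensorProduct.tprod ℂ f) =
      PiTensorProduct.tprod ℂ (Fin.cons m f : Fin (k + 1) → M) := by
  rw [consTensor, PiTensorProduct.lift.tprod, MultilinearMap.curryLeft_apply]

theorem consTensor_smul {k : ℕ} (a : ℂ) (m : M) (t : ⨂[ℂ] _ : Fin k, M) :
    consTensor k (a • m) t = a • consTensor k m t := by
  simp only [consTensor, map_smul, LinearMap.smul_apply]

theorem consTensor_sub {k : ℕ} (m m' : M) (t : ⨂[ℂ] _ : Fin k, M) :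
    consTensor k (m - m') t = consTensor k m t - consTensor k m' t := by
  simp only [consTensor, map_sub, LinearMap.sub_apply]

theorem consTensor_induction {k : ℕ} {P : (⨂[ℂ] _ : Fin (k + 1), M) → Prop}
    (hc : ∀ (m : M) (t : ⨂[ℂ] _ : Fin k, M), P (consTensor k m t))
    (ha : ∀ t u, P t → P u → P (t + u)) (t : ⨂[ℂ] _ : Fin (k + 1), M) : P t := by
  induction t using PiTensorProduct.induction_on with
  | add x y hx hy => exact ha x y hx hy
  | smul_tprod a f =>
    have h := hc (f 0) (a • PiTensorProduct.tprod ℂ (Fin.tail f))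
    rwa [map_smul, consTensor_tprod, Fin.cons_self_tail] at h

theorem tensorAct_consTensor {k : ℕ} (g : Module.End ℂ M) (m : M) (t : ⨂[ℂ] _ : Fin k, M) :
    tensorAct (k + 1) g (consTensor k m t) =
      consTensor k (g m) t + consTensor k m (tensorAct k g t) := by
  induction t using PiTensorProduct.induction_on with
  | add x y hx hy => simp only [map_add, hx, hy]; abel
  | smul_tprod a f =>
    simp only [map_smul, ← smul_add]
    congr 1
    rw [consTensor_tprod, consTensor_tprod, tensorAct_tprod, tensorAct_tprod, Fin.sum_univ_succ,
      map_sum]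
    congr 1
    · rw [Fin.cons_zero, Fin.update_cons_zero]
      rfl
    · refine Finset.sum_congr rfl fun i _ => ?_
      rw [consTensor_tprod, Fin.cons_succ, Fin.cons_update]

variable {B : Type*} [Ring B] [Algebra ℂ B] (β : B →ₐ[ℂ] Module.End ℂ M) (c : M →ₗ[ℂ] B)
  {V : Type*} [AddCommGroup V] [Module ℂ V] (ρ : B →ₗ[ℂ] Module.End ℂ V) (v : V)

/-- The normally ordered products `:m₁ ⋯ m_k: v`, defined by
`:m₀ m₁ ⋯ m_k: v = m₀ (:m₁ ⋯ m_k: v) - ∑ᵢ :m₁ ⋯ (m₀ mᵢ) ⋯ m_k: v`. -/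
noncomputable def orderedProduct : (k : ℕ) → (⨂[ℂ] _ : Fin k, M) →ₗ[ℂ] V
  | 0 => PiTensorProduct.lift (MultilinearMap.constOfIsEmpty ℂ (fun _ : Fin 0 => M) v)
  | k + 1 => PiTensorProduct.lift (LinearMap.uncurryLeft
      { toFun := fun m => (ρ (c m) ∘ₗ orderedProduct k -
          orderedProduct k ∘ₗ tensorAct k (β (c m))).compMultilinearMap (PiTensorProduct.tprod ℂ)
        map_add' := fun m m' => by
          ext f
          simp only [map_add, tensorAct_add, LinearMap.add_comp, LinearMap.comp_add,
            LinearMap.compMultilinearMap_apply, LinearMap.sub_apply, LinearMap.add_apply,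
            add_apply]
          abel
        map_smul' := fun a m => by
          ext f
          simp only [map_smul, tensorAct_smul, LinearMap.smul_comp, LinearMap.comp_smul,
            LinearMap.compMultilinearMap_apply, LinearMap.sub_apply, LinearMap.smul_apply,
            smul_apply, RingHom.id_apply, smul_sub] })

theorem orderedProduct_zero (f : Fin 0 → M) :
    orderedProduct β c ρ v 0 (PiTensorProduct.tprod ℂ f) = v := by
  rw [orderedProduct, PiTensorProduct.lift.tprod, MultilinearMap.constOfIsEmpty_apply,
    Function.const_apply]

theorem orderedProduct_consTensor {k : ℕ} (m : M) (t : ⨂[ℂ] _ : Fin k, M) :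
    orderedProduct β c ρ v (k + 1) (consTensor k m t) =
      ρ (c m) (orderedProduct β c ρ v k t) -
        orderedProduct β c ρ v k (tensorAct k (β (c m)) t) := by
  induction t using PiTensorProduct.induction_on with
  | add x y hx hy => simp only [map_add, hx, hy]; abel
  | smul_tprod a f =>
    simp only [map_smul, ← smul_sub]
    rw [consTensor_tprod, orderedProduct, PiTensorProduct.lift.tprod,
      LinearMap.uncurryLeft_apply, Fin.cons_zero, Fin.tail_cons]
    rfl

variable {β c ρ v} {m₀ : M}

-- Under `hc` and `hm₀`, `c` embeds `M` as a left ideal of `B` complementary to the annihilator of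
-- `m₀`. By `hρ`, `ρ` respects commutators only, not products. By `hv`, the annihilator of `m₀`
-- kills `v`. In the application `B = gl ⊗ A`, `M = V ⊗ A` and `c` is the inclusion as first column.
variable (hc : ∀ x m, c (β x m) = x * c m) (hm₀ : ∀ m, β (c m) m₀ = m)
  (hρ : ∀ x y, ρ (x * y - y * x) = ρ x * ρ y - ρ y * ρ x)
  (hv : ∀ x, ρ x v = ρ (c (β x m₀)) v)

theorem tensorAct_commutator (k : ℕ) (x y : B) (t : ⨂[ℂ] _ : Fin k, M) :
    tensorAct k (β (x * y - y * x)) t =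
      tensorAct k (β x) (tensorAct k (β y) t) - tensorAct k (β y) (tensorAct k (β x) t) := by
  rw [← tensorAct_lie, LieRing.of_associative_ring_bracket, map_sub, map_mul, map_mul]

include hc hm₀ hρ hv in
/-- The action of `B` on ordered products. -/
theorem act_orderedProduct {k : ℕ} (x : B) (t : ⨂[ℂ] _ : Fin k, M) :
    ρ x (orderedProduct β c ρ v k t) =
      orderedProduct β c ρ v (k + 1) (consTensor k (β x m₀) t) +
        orderedProduct β c ρ v k (tensorAct k (β x) t) := by
  -- For `x = c m` the claim is the recursion defining ordered products. Subtracting `c (β x m₀)`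
  -- leaves an element that annihilates `m₀`.
  suffices h : ∀ k (x : B), β x m₀ = 0 → ∀ t : ⨂[ℂ] _ : Fin k, M,
      ρ x (orderedProduct β c ρ v k t) = orderedProduct β c ρ v k (tensorAct k (β x) t) by
    have h1 := h k (x - c (β x m₀)) (by rw [map_sub, LinearMap.sub_apply, hm₀, sub_self]) t
    have h2 : tensorAct k (β (x - c (β x m₀))) t =
        tensorAct k (β x) t - tensorAct k (β (c (β x m₀))) t := by
      have h3 := tensorAct_add (M := M) k (β (x - c (β x m₀))) (β (c (β x m₀)))
      rw [← map_add, sub_add_cancel] at h3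
      rw [h3, LinearMap.add_apply, add_sub_cancel_right]
    rw [map_sub, LinearMap.sub_apply, h2, map_sub] at h1
    rw [orderedProduct_consTensor, ← sub_eq_zero]
    rw [← sub_eq_zero] at h1
    rw [← h1]
    abel
  clear t x
  intro k
  induction k with
  | zero =>
    intro x hx t
    induction t using PiTensorProduct.induction_on with
    | add a b ha hb => simp only [map_add, ha, hb]
    | smul_tprod a f =>
      simp only [map_smul]
      rw [orderedProduct_zero, hv, hx, map_zero, map_zero, LinearMap.zero_apply, tensorAct_tprod,
        Finset.univ_eq_empty, Finset.sum_empty, map_zero]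
  | succ k ih =>
    intro x hx t
    induction t using consTensor_induction with
    | ha a b ha hb => simp only [map_add, ha, hb]
    | hc m t =>
      -- Move `x` past `c m` using `x * c m = c (β x m)`. The correction term involves `c m * x`,
      -- which again annihilates `m₀`; for this reason the induction hypothesis ranges over all such
      -- elements.
      have e1 : ρ x (ρ (c m) (orderedProduct β c ρ v k t)) =
          ρ (c (β x m)) (orderedProduct β c ρ v k t) -
          ρ (c m * x) (orderedProduct β c ρ v k t) +
          ρ (c m) (ρ x (orderedProduct β c ρ v k t)) := by
        have h1 := congrArg (fun g : Module.End ℂ V => g (orderedProduct β c ρ v k t)) (hρ x (c m))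
        simp only [LinearMap.sub_apply, Module.End.mul_apply, map_sub] at h1
        rw [hc, h1]
        abel
      have e2 : β (c m * x) m₀ = 0 := by rw [map_mul, Module.End.mul_apply, hx, map_zero]
      have e3 : tensorAct k (β x) (tensorAct k (β (c m)) t) = tensorAct k (β (c (β x m))) t -
          tensorAct k (β (c m * x)) t + tensorAct k (β (c m)) (tensorAct k (β x) t) := by
        have h2 := tensorAct_commutator (β := β) k x (c m) t
        have h3 := tensorAct_add (M := M) k (β (x * c m - c m * x)) (β (c m * x))
        rw [← map_add, sub_add_cancel] at h3
        rw [hc, h3, LinearMap.add_apply, h2]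
        abel
      rw [tensorAct_consTensor, map_add, orderedProduct_consTensor, orderedProduct_consTensor,
        orderedProduct_consTensor, map_sub, e1, ih _ e2, ih x hx, ih x hx, e3]
      simp only [map_add, map_sub]
      abel

-- Both `ρ` and the derivation action turn the commutator `[c m, c m']` into a commutator of
-- operators, and `[c m, c m'] = c (β (c m) m' - β (c m') m)` is a first column again. The
-- corrections in the two recursions differ by exactly this term.
include hc hρ in
theorem orderedProduct_swap_zero {k : ℕ} (m m' : M) (t : ⨂[ℂ] _ : Fin k, M) :
    orderedProduct β c ρ v (k + 2) (consTensor (k + 1) m (consTensor k m' t)) =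
      orderedProduct β c ρ v (k + 2) (consTensor (k + 1) m' (consTensor k m t)) := by
  have h : c m * c m' - c m' * c m = c (β (c m) m' - β (c m') m) := by
    rw [map_sub, hc, hc]
  have h1 := congrArg (fun g : Module.End ℂ V => g (orderedProduct β c ρ v k t)) (hρ (c m) (c m'))
  simp only [LinearMap.sub_apply, Module.End.mul_apply] at h1
  have h2 := tensorAct_commutator (β := β) k (c m) (c m') t
  rw [h] at h1 h2
  have h3 := orderedProduct_consTensor β c ρ v (β (c m) m' - β (c m') m) t
  rw [h1, h2, consTensor_sub, map_sub, map_sub] at h3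
  simp only [orderedProduct_consTensor β c ρ v (k := k + 1), tensorAct_consTensor, map_add]
  simp only [orderedProduct_consTensor β c ρ v (k := k), map_sub] at h3 ⊢
  rw [← sub_eq_zero] at h3 ⊢
  rw [← neg_eq_zero, ← h3]
  abel

include hc hρ in
/-- Ordered products are symmetric in their factors. -/
theorem orderedProduct_comp_perm {k : ℕ} (σ : Equiv.Perm (Fin k)) (f : Fin k → M) :
    orderedProduct β c ρ v k (PiTensorProduct.tprod ℂ (f ∘ σ)) =
      orderedProduct β c ρ v k (PiTensorProduct.tprod ℂ f) := by
  induction k with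
  | zero => rw [Subsingleton.elim (f ∘ σ) f]
  | succ k ih =>
    -- Adjacent transpositions suffice. The one moving the first factor is
    -- `orderedProduct_swap_zero`. The others leave the first factor in place and permute the tail,
    -- on which the recursion acts by an operator that commutes with permutations.
    have hσ : σ ∈ Submonoid.closure
        (Set.range fun i : Fin k => Equiv.swap i.castSucc i.succ) := by
      rw [Equiv.Perm.mclosure_swap_castSucc_succ]; trivial
    induction hσ using Submonoid.closure_induction generalizing f with
    | one => rfl
    | mul σ τ _ _ h1 h2 =>
      rw [Equiv.Perm.coe_mul, ← Function.comp_assoc, h2, h1]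
    | mem σ hσ =>
      obtain ⟨i, rfl⟩ := hσ
      obtain ⟨k, rfl⟩ : ∃ l, k = l + 1 := ⟨k - 1, by have := i.pos; omega⟩
      refine Fin.cases ?_ (fun i => ?_) i
      · have e1 : PiTensorProduct.tprod ℂ f = consTensor (k + 1) (f 0)
            (consTensor k (f 1) (PiTensorProduct.tprod ℂ fun j => f j.succ.succ)) := by
          rw [consTensor_tprod, consTensor_tprod]
          congr 1
          funext j
          refine Fin.cases rfl (fun j => ?_) j
          refine Fin.cases rfl (fun j => rfl) j
        have e2 : PiTensorProduct.tprod ℂ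
            (f ∘ Equiv.swap (Fin.castSucc (0 : Fin (k + 1))) (Fin.succ 0)) =
            consTensor (k + 1) (f 1)
            (consTensor k (f 0) (PiTensorProduct.tprod ℂ fun j => f j.succ.succ)) := by
          rw [consTensor_tprod, consTensor_tprod]
          congr 1
          funext j
          refine Fin.cases ?_ (fun j => ?_) j
          · simp
          refine Fin.cases ?_ (fun j => ?_) j
          · simp
          · simp only [Function.comp_apply, Fin.cons_succ]
            rw [Equiv.swap_apply_of_ne_of_ne]
            · exact Fin.succ_ne_zero _
            · intro h
              exact Fin.succ_ne_zero _ (Fin.succ_injective _ h)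
        rw [e1, e2]
        exact orderedProduct_swap_zero hc hρ _ _ _
      · have e1 : PiTensorProduct.tprod ℂ f = consTensor (k + 1) (f 0)
            (PiTensorProduct.tprod ℂ (Fin.tail f)) := by
          rw [consTensor_tprod, Fin.cons_self_tail]
        have e2 : PiTensorProduct.tprod ℂ
            (f ∘ Equiv.swap (Fin.castSucc i.succ) (Fin.succ i.succ)) = consTensor (k + 1) (f 0)
            (PiTensorProduct.tprod ℂ (Fin.tail f ∘ Equiv.swap i.castSucc i.succ)) := by
          rw [consTensor_tprod]
          congr 1
          funext j
          refine Fin.cases ?_ (fun j => ?_) j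
          · simp only [Function.comp_apply, Fin.cons_zero]
            rw [Equiv.swap_apply_of_ne_of_ne]
            · rw [Fin.castSucc_succ]
              exact (Fin.succ_ne_zero _).symm
            · exact (Fin.succ_ne_zero _).symm
          · simp only [Function.comp_apply, Fin.cons_succ, Fin.tail]
            rw [Fin.castSucc_succ, ← (Fin.succ_injective _).swap_apply]
        have e3 : tensorAct (k + 1) (β (c (f 0)))
            (PiTensorProduct.tprod ℂ (Fin.tail f ∘ Equiv.swap i.castSucc i.succ)) =
            PiTensorProduct.reindex ℂ (fun _ => M) (Equiv.swap i.castSucc i.succ)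
              (tensorAct (k + 1) (β (c (f 0))) (PiTensorProduct.tprod ℂ (Fin.tail f))) := by
          rw [tensorAct_reindex, PiTensorProduct.reindex_tprod, Equiv.symm_swap]
          rfl
        have e4 : ∀ (τ : Equiv.Perm (Fin (k + 1))) (t : ⨂[ℂ] _ : Fin (k + 1), M),
            orderedProduct β c ρ v (k + 1) (PiTensorProduct.reindex ℂ (fun _ => M) τ t) =
            orderedProduct β c ρ v (k + 1) t := fun τ t => by
          induction t using PiTensorProduct.induction_on with
          | add x y hx hy => simp only [map_add, hx, hy]
          | smul_tprod a g =>
            simp only [map_smul]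
            rw [PiTensorProduct.reindex_tprod]
            congr 1
            exact ih τ.symm g
        rw [e1, e2, orderedProduct_consTensor, orderedProduct_consTensor, e3, e4, ih]

theorem tensorAct_tprod_const {L : Type*} [LieRing L] [LieAlgebra ℂ L] [LieRingModule L M]
    [LieModule ℂ L M] (k : ℕ) (x : L) (m : M) (a : ℂ)
    (h : ⁅x, m⁆ = a • m) : tensorAct k x (PiTensorProduct.tprod ℂ fun _ : Fin k => m) =
      ((k : ℂ) * a) • PiTensorProduct.tprod ℂ fun _ : Fin k => m := by
  rw [tensorAct_tprod, h]
  simp only [MultilinearMap.map_update_smul, Function.update_eq_self]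
  rw [Finset.sum_const, Finset.card_univ, Fintype.card_fin, ← Nat.cast_smul_eq_nsmul ℂ, smul_smul]

theorem tprod_const_succ (k : ℕ) (m : M) :
    (PiTensorProduct.tprod ℂ fun _ : Fin (k + 1) => m) =
      consTensor k m (PiTensorProduct.tprod ℂ fun _ : Fin k => m) := by
  rw [consTensor_tprod]
  congr 1
  funext j
  exact (Fin.cases rfl (fun _ => rfl) j)

/-- Each of the `k` factors already present lowers the eigenvalue `b` by `a`. With `m = m₀`, `a = 1`
and `b = k = n` the product is `n!`, the normalization of the equivariant map. -/
theorem orderedProduct_const {m : M} {a b : ℂ} (hm : β (c m) m = a • m) (hb : ρ (c m) v = b • v)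
    (k : ℕ) : orderedProduct β c ρ v k (PiTensorProduct.tprod ℂ fun _ => m) =
      (∏ i ∈ Finset.range k, (b - i * a)) • v := by
  induction k with
  | zero => rw [Finset.prod_range_zero, one_smul, orderedProduct_zero]
  | succ k ih =>
    rw [tprod_const_succ, orderedProduct_consTensor, tensorAct_tprod_const k _ m a hm, map_smul, ih,
      map_smul, hb, Finset.prod_range_succ, smul_smul, smul_smul, ← sub_smul]
    congr 1
    ring

/-- Here the corrections in the recursion all vanish. This translates nilpotency of a root vector on
`v` into the vanishing of one ordered product. -/
theorem orderedProduct_const_of_eq_zero {m : M} (hm : β (c m) m = 0) (k : ℕ) :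
    orderedProduct β c ρ v k (PiTensorProduct.tprod ℂ fun _ => m) = (ρ (c m) ^ k) v := by
  induction k with
  | zero => rw [orderedProduct_zero, pow_zero, Module.End.one_apply]
  | succ k ih =>
    rw [tprod_const_succ, orderedProduct_consTensor,
      tensorAct_tprod_const k _ m 0 (hm.trans (zero_smul ℂ m).symm), mul_zero, zero_smul, map_zero,
      sub_zero, ih, pow_succ', Module.End.mul_apply]

include hc hm₀ hρ hv in
/-- A criterion for the vanishing of the ordered products of `k` factors. -/
theorem orderedProduct_eq_zero {m₁ : M} (hm₁ : β (c m₁) m₁ = 0) {k : ℕ}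
    (hk : (ρ (c m₁) ^ k) v = 0)
    (hspan : Submodule.span ℂ {m | ∃ x, β x m₀ = 0 ∧ β x m₁ = m} = ⊤) :
    orderedProduct β c ρ v k = 0 := by
  refine PiTensorProduct.ext (MultilinearMap.ext fun m => ?_)
  -- Polarization starting from `m₁`, with the zero subspace as `Y`. The operators used annihilate
  -- `m₀`, so in `act_orderedProduct` the term with an extra factor drops out and vanishing is
  -- preserved by their derivations. By `hspan` they still move `m₁` to a spanning set.
  have := multilinear_mem_of_const_mem
    ((orderedProduct β c ρ v k).compMultilinearMap (PiTensorProduct.tprod ℂ))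
    (fun σ m => orderedProduct_comp_perm hc hρ σ m) ⊥ m₁ ?_
    {g | ∃ x, β x m₀ = 0 ∧ β x = g} ?_ ?_ m
  · exact (Submodule.mem_bot ℂ).1 this
  · rw [Submodule.mem_bot, LinearMap.compMultilinearMap_apply,
      orderedProduct_const_of_eq_zero hm₁, hk]
  · rw [eq_top_iff, ← hspan]
    refine Submodule.span_mono ?_
    rintro _ ⟨x, hx, rfl⟩
    exact ⟨_, ⟨x, hx, rfl⟩, rfl⟩
  · rintro _ ⟨x, hx, rfl⟩ m hm
    rw [Submodule.mem_bot] at hm ⊢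
    rw [LinearMap.compMultilinearMap_apply] at hm
    have h1 := act_orderedProduct hc hm₀ hρ hv x (PiTensorProduct.tprod ℂ m)
    have h2 : consTensor k (0 : M) (PiTensorProduct.tprod ℂ m) = 0 := by
      have := consTensor_smul (0 : ℂ) (0 : M) (PiTensorProduct.tprod ℂ m)
      rwa [zero_smul, zero_smul] at this
    rw [hx, h2, map_zero, zero_add, tensorAct_tprod, map_sum, hm, map_zero] at h1
    exact h1.symm

include hc hm₀ hρ hv in
/-- A vector `v` with the same annihilation properties as `m₀ ⊗ ⋯ ⊗ m₀` is the image of a nonzero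
multiple of that tensor under an equivariant map. -/
theorem exists_equivariant_map {m₁ : M} (hm₁ : β (c m₁) m₁ = 0) {n : ℕ}
    (hk : (ρ (c m₁) ^ (n + 1)) v = 0)
    (hspan : Submodule.span ℂ {m | ∃ x, β x m₀ = 0 ∧ β x m₁ = m} = ⊤)
    (hn : ρ (c m₀) v = (n : ℂ) • v) :
    ∃ T : (⨂[ℂ] _ : Fin n, M) →ₗ[ℂ] V,
      (∀ x t, ρ x (T t) = T (tensorAct n (β x) t)) ∧
      T (PiTensorProduct.tprod ℂ fun _ => m₀) = v := by
  have hfac : ∏ i ∈ Finset.range n, ((n : ℂ) - i * 1) ≠ 0 := by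
    rw [Finset.prod_ne_zero_iff]
    intro i hi
    rw [sub_ne_zero, mul_one]
    exact fun h => (Finset.mem_range.1 hi).ne' (Nat.cast_injective h)
  -- The factor is `1/n!`. Equivariance is `act_orderedProduct` for `k = n`, where the term with `n
  -- + 1` factors is zero.
  refine ⟨(∏ i ∈ Finset.range n, ((n : ℂ) - i * 1))⁻¹ • orderedProduct β c ρ v n, fun x t => ?_, ?_⟩
  · rw [LinearMap.smul_apply, map_smul, act_orderedProduct hc hm₀ hρ hv,
      orderedProduct_eq_zero hc hm₀ hρ hv hm₁ hk hspan, LinearMap.zero_apply, zero_add,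
      LinearMap.smul_apply]
  · rw [LinearMap.smul_apply,
      orderedProduct_const ((hm₀ m₀).trans (one_smul ℂ m₀).symm) hn, inv_smul_smul₀ hfac]

end OrderedProducts


/-! ### Nilpotency in representations of `sl₂`. -/

section Sl2

/-- In a representation of an `sl₂`-triple, if `f` acts nilpotently on a vector that is killed by
`e` and has weight `n`, then `f ^ (n + 1)` kills it. -/
theorem sl2_pow_eq_zero {L V : Type*} [LieRing L] [LieAlgebra ℂ L] [AddCommGroup V] [Module ℂ V]
    [LieRingModule L V] [LieModule ℂ L V] {h e f : L} (hef : ⁅e, f⁆ = h) (hhe : ⁅h, e⁆ = 2 • e)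
    (hhf : ⁅h, f⁆ = -(2 • f)) {u : V} {n : ℕ} (hu : ⁅h, u⁆ = (n : ℂ) • u) (eu : ⁅e, u⁆ = 0)
    (hN : ∃ N, (LieModule.toEnd ℂ L V f ^ N) u = 0) :
    (LieModule.toEnd ℂ L V f ^ (n + 1)) u = 0 := by
  by_cases hu0 : u = 0
  · rw [hu0, map_zero]
  -- `IsSl2Triple` requires `h ≠ 0`, while the triple collapses in `Current r A` when `A` is the
  -- zero ring.
  by_cases hh : h = 0
  · have hf : f = 0 := by
      rw [hh, zero_lie, eq_comm, neg_eq_zero] at hhf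
      have h2 : (2 : ℂ) • f = 0 := by rw [← hhf, ← Nat.cast_smul_eq_nsmul ℂ]; norm_num
      exact (smul_eq_zero.1 h2).resolve_left two_ne_zero
    rw [hf, map_zero, zero_pow (Nat.succ_ne_zero n), LinearMap.zero_apply]
  have t : IsSl2Triple h e f := ⟨hh, hef, hhe, hhf⟩
  have P : t.HasPrimitiveVectorWith u (n : ℂ) := ⟨hu0, hu, eu⟩
  obtain ⟨N, hN⟩ := hN
  induction N with
  | zero => exact absurd hN hu0
  | succ N ih =>
    -- Descent by `e f^{N+1} u = (N + 1)(n - N) f^N u`: the exponent can be lowered unless `N = n`,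
    -- and it cannot reach `0` because `u ≠ 0`.
    by_cases hNn : N = n
    · rw [← hNn]; exact hN
    · apply ih
      have h1 := P.lie_e_pow_succ_toEnd_f N
      rw [hN, lie_zero, eq_comm, smul_eq_zero] at h1
      refine h1.resolve_left (mul_ne_zero (Nat.cast_add_one_ne_zero N) ?_)
      rw [sub_ne_zero]
      exact fun hh => hNn (Nat.cast_injective hh).symm

end Sl2

/-! ### Matrix units and their brackets. -/

section Matrices

variable {r : ℕ}

open LieAlgebra.SpecialLinear

/-- The matrix unit `E_{ij}`. -/
noncomputable def matE (i j : Fin (r + 1)) (h : i ≠ j) : SL r := single i j h 1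

/-- The diagonal matrix `E_{ii} - E_{jj}`. -/
noncomputable def matH (i j : Fin (r + 1)) : SL r := singleSubSingle i j 1

theorem matE_val (i j : Fin (r + 1)) (h : i ≠ j) : (matE i j h).val = Matrix.single i j 1 := rfl

theorem matH_val (i j : Fin (r + 1)) :
    (matH i j).val = Matrix.single i i 1 - Matrix.single j j 1 := rfl

theorem lie_matE_matE (i j : Fin (r + 1)) (h : i ≠ j) :
    ⁅matE i j h, matE j i h.symm⁆ = matH i j := by
  refine Subtype.ext ?_
  rw [sl_bracket, matE_val, matE_val, matH_val]
  simp

theorem matH_mem_cartan (i j : Fin (r + 1)) : matH i j ∈ cartan r := fun a b h => by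
  rw [matH_val, Matrix.sub_apply, Matrix.single_apply, Matrix.single_apply,
    if_neg (fun hh => h (hh.1.symm.trans hh.2)), if_neg (fun hh => h (hh.1.symm.trans hh.2)),
    sub_zero]

theorem lie_cartan_matE (x : SL r) (hx : x ∈ cartan r) (i j : Fin (r + 1)) (h : i ≠ j) :
    ⁅x, matE i j h⁆ = (x.val i i - x.val j j) • matE i j h := by
  refine Subtype.ext ?_
  rw [sl_bracket]
  change x.val * Matrix.single i j 1 - Matrix.single i j 1 * x.val =
    (x.val i i - x.val j j) • Matrix.single i j (1 : ℂ)
  ext a b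
  rw [Matrix.sub_apply, Matrix.smul_apply]
  by_cases ha : a = i
  · subst ha
    by_cases hb : b = j
    · subst hb
      simp
    · rw [Matrix.mul_single_apply_of_ne _ _ _ _ _ hb, Matrix.single_mul_apply_same,
        hx _ _ (Ne.symm hb), Matrix.single_apply, if_neg (fun hh => hb hh.2.symm)]
      simp
  · rw [Matrix.single_mul_apply_of_ne _ _ _ _ _ ha,
      Matrix.single_apply, if_neg (fun hh => ha hh.1.symm)]
    by_cases hb : b = j
    · subst hb
      rw [Matrix.mul_single_apply_same, hx _ _ ha]
      simp
    · rw [Matrix.mul_single_apply_of_ne _ _ _ _ _ hb]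
      simp

theorem matH_apply (i j a : Fin (r + 1)) :
    (matH i j).val a a = (if a = i then 1 else 0) - (if a = j then 1 else 0) := by
  rw [matH_val, Matrix.sub_apply, Matrix.single_apply, Matrix.single_apply]
  simp only [and_self, eq_comm]

theorem lie_matH_matE (i j : Fin (r + 1)) (h : i ≠ j) :
    ⁅matH i j, matE i j h⁆ = 2 • matE i j h := by
  rw [lie_cartan_matE _ (matH_mem_cartan i j), matH_apply, matH_apply, if_pos rfl, if_neg h,
    if_neg h.symm, if_pos rfl, ← Nat.cast_smul_eq_nsmul ℂ]
  norm_num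

theorem lie_matH_matE_symm (i j : Fin (r + 1)) (h : i ≠ j) :
    ⁅matH i j, matE j i h.symm⁆ = -(2 • matE j i h.symm) := by
  rw [lie_cartan_matE _ (matH_mem_cartan i j), matH_apply, matH_apply, if_pos rfl, if_neg h,
    if_neg h.symm, if_pos rfl, ← Nat.cast_smul_eq_nsmul ℂ, ← neg_smul]
  norm_num

/-- A traceless matrix lies in a subspace that contains enough matrix units and matrices
`E_{ii} - E_{kk}`. -/
theorem sl_mem_of_matE_mem (x : SL r) (k : Fin (r + 1)) (Y : Submodule ℂ (SL r))
    (hE : ∀ i j (h : i ≠ j), x.val i j ≠ 0 → matE i j h ∈ Y)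
    (hH : ∀ i, i ≠ k → x.val i i ≠ 0 → matH i k ∈ Y) : x ∈ Y := by
  -- The diagonal terms contribute an excess `-(tr x) E_{kk}`, which is zero.
  have key : x = ∑ i, ∑ j, if h : i = j then x.val i i • matH i k else x.val i j • matE i j h := by
    refine Subtype.ext ?_
    have h1 : ∀ i j, (if h : i = j then x.val i i • matH i k else x.val i j • matE i j h : SL r).val =
        Matrix.single i j (x.val i j) - if i = j then Matrix.single k k (x.val i j) else 0 := by
      intro i j
      by_cases h : i = j
      · subst h
        rw [dif_pos rfl, if_pos rfl]
        change x.val i i • (Matrix.single i i (1 : ℂ) - Matrix.single k k 1) = _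
        rw [smul_sub, Matrix.smul_single, Matrix.smul_single, smul_eq_mul, mul_one]
      · rw [dif_neg h, if_neg h]
        change x.val i j • Matrix.single i j (1 : ℂ) = _
        rw [Matrix.smul_single, smul_eq_mul, mul_one, sub_zero]
    have h2 : ∑ i, Matrix.single k k (x.val i i) = 0 := by
      have ht : Matrix.trace x.val = 0 := x.property
      change ∑ i, x.val i i = 0 at ht
      have := map_sum (Matrix.singleAddMonoidHom (α := ℂ) k k) (fun i => x.val i i) Finset.univ
      rw [ht, map_zero] at this
      exact this.symm
    let v : SL r →ₗ[ℂ] Matrix (Fin (r + 1)) (Fin (r + 1)) ℂ :=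
      { toFun := fun y => y.val, map_add' := fun _ _ => rfl, map_smul' := fun _ _ => rfl }
    have h3 := map_sum v
      (fun i => ∑ j, if h : i = j then x.val i i • matH i k else x.val i j • matE i j h) Finset.univ
    change (∑ i, ∑ j, _ : SL r).val = _ at h3
    rw [h3]
    simp only [map_sum]
    have h4 : ∀ i j, v
        (if h : i = j then x.val i i • matH i k else x.val i j • matE i j h) =
        Matrix.single i j (x.val i j) - if i = j then Matrix.single k k (x.val i j) else 0 := h1
    simp only [h4, Finset.sum_sub_distrib, Finset.sum_ite_eq, Finset.mem_univ, if_true]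
    rw [h2, sub_zero]
    exact Matrix.matrix_eq_sum_single x.val
  rw [key]
  refine Y.sum_mem fun i _ => Y.sum_mem fun j _ => ?_
  by_cases h : i = j
  · rw [dif_pos h]
    by_cases hx : x.val i i = 0
    · rw [hx, zero_smul]; exact Y.zero_mem
    · by_cases hk : i = k
      · subst hk
        have : matH i i = (0 : SL r) := Subtype.ext (sub_self _)
        rw [this, smul_zero]; exact Y.zero_mem
      · exact Y.smul_mem _ (hH i hk hx)
  · rw [dif_neg h]
    by_cases hx : x.val i j = 0
    · rw [hx, zero_smul]; exact Y.zero_mem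
    · exact Y.smul_mem _ (hE i j h hx)

/-- The weight `h ↦ h_{jj}`. -/
def diagWeight (r : ℕ) (j : Fin (r + 1)) : Weight r where
  toFun h := h.val.val j j
  map_add' _ _ := rfl
  map_smul' _ _ := rfl

theorem fundamentalWeight_zero_apply [NeZero r] (h : cartan r) :
    fundamentalWeight r 0 h = h.val.val 0 0 := by
  change (∑ j : Fin (r + 1), if j ≤ (0 : Fin r).castSucc then h.val.val j j else 0) = _
  rw [Finset.sum_eq_single 0]
  · rw [if_pos (Fin.zero_le _)]
  · intro j _ hj
    rw [if_neg]
    rwa [Fin.castSucc_zero, Fin.le_zero_iff]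
  · intro h; exact absurd (Finset.mem_univ _) h

end Matrices

/-! ### Weight spaces and integrable modules. -/

section Integrable

variable {r : ℕ} (A : Type*) [CommRing A] [Algebra ℂ A] (V : Type*) [AddCommGroup V] [Module ℂ V]
  [LieRingModule (Current r A) V] [LieModule ℂ (Current r A) V]

theorem lie_cartan_cartan {x y : SL r} (hx : x ∈ cartan r) (hy : y ∈ cartan r) : ⁅x, y⁆ = 0 := by
  refine Subtype.ext ?_
  rw [LieAlgebra.SpecialLinear.sl_bracket]
  refine sub_eq_zero.2 ?_
  ext a b
  rw [Matrix.mul_apply, Matrix.mul_apply, Finset.sum_eq_single b, Finset.sum_eq_single b]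
  · by_cases h : a = b
    · subst h; ring
    · rw [hx a b h, hy a b h]; ring
  · intro c _ hc; rw [hx c b hc, mul_zero]
  · intro h; exact absurd (Finset.mem_univ _) h
  · intro c _ hc; rw [hy c b hc, mul_zero]
  · intro h; exact absurd (Finset.mem_univ _) h

/-- Weight subspaces are independent. -/
theorem iSupIndep_weightSubspace : iSupIndep fun μ : Weight r => weightSubspace A V μ := by
  let f : cartan r → Module.End ℂ V := fun h =>
    LieModule.toEnd ℂ (Current r A) V ((1 : A) ⊗ₜ[ℂ] h.val)
  have hcomm : ∀ h h', Commute (f h) (f h') := fun h h' => by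
    refine LinearMap.ext fun v => ?_
    change ⁅_, ⁅_, v⁆⁆ = ⁅_, ⁅_, v⁆⁆
    rw [leibniz_lie, LieAlgebra.ExtendScalars.bracket_tmul,
      lie_cartan_cartan h.property h'.property, TensorProduct.tmul_zero, zero_lie, zero_add]
  -- The Cartan subalgebra acts by commuting operators, and weight subspaces lie in the simultaneous
  -- generalized eigenspaces of these operators.
  have h1 := Module.End.independent_iInf_maxGenEigenspace_of_forall_mapsTo f
    (fun i j φ => Module.End.mapsTo_maxGenEigenspace_of_comm (hcomm j i) φ)
  have h2 := h1.comp (f := fun μ : Weight r => (μ : cartan r → ℂ)) DFunLike.coe_injective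
  refine h2.mono fun μ v hv => ?_
  simp only [Function.comp_apply, Submodule.mem_iInf]
  intro h
  refine Module.End.mem_maxGenEigenspace _ _ _ |>.2 ⟨1, ?_⟩
  rw [pow_one, LinearMap.sub_apply, LinearMap.smul_apply, Module.End.one_apply, sub_eq_zero]
  exact hv h

variable {A V}

/-- Independence of weight subspaces is automatic, so only the spanning condition needs to be
checked. -/
theorem isIntegrable_of_iSup_eq_top (D : Finset (Weight r)) (hD : ∀ μ ∈ D, IsIntegral μ)
    (h : ⨆ μ ∈ D, weightSubspace A V μ = ⊤) : IsIntegrable r A V := by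
  classical
  refine ⟨D, hD, ?_⟩
  rw [DirectSum.isInternal_submodule_iff_iSupIndep_and_iSup_eq_top]
  exact ⟨(iSupIndep_weightSubspace A V).comp Subtype.val_injective, by rw [iSup_subtype]; exact h⟩

theorem IsIntegrable.exists_finset (h : IsIntegrable r A V) :
    ∃ D : Finset (Weight r), (∀ μ ∈ D, IsIntegral μ) ∧ ⨆ μ ∈ D, weightSubspace A V μ = ⊤ := by
  classical
  obtain ⟨D, hD, hi⟩ := h
  rw [DirectSum.isInternal_submodule_iff_iSupIndep_and_iSup_eq_top] at hi
  exact ⟨D, hD, by rw [← hi.2, iSup_subtype]⟩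

theorem weightSubspace_eq_bot {D : Finset (Weight r)} (h : ⨆ μ ∈ D, weightSubspace A V μ = ⊤)
    {ν : Weight r} (hν : ν ∉ D) : weightSubspace A V ν = ⊥ := by
  have h1 := iSupIndep_weightSubspace A V ν
  have h2 : (⊤ : Submodule ℂ V) ≤ ⨆ (μ : Weight r) (_ : μ ≠ ν), weightSubspace A V μ := by
    rw [← h]
    refine iSup₂_le fun μ hμ => ?_
    exact le_iSup₂_of_le μ (fun hh => hν (hh ▸ hμ)) le_rfl
  exact disjoint_top.1 (h1.mono_right h2)

/-- Quotients of integrable modules are integrable. -/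
theorem IsIntegrable.of_surjective {V' : Type*} [AddCommGroup V'] [Module ℂ V']
    [LieRingModule (Current r A) V'] [LieModule ℂ (Current r A) V'] (h : IsIntegrable r A V)
    (φ : V →ₗ⁅ℂ, Current r A⁆ V') (hφ : Function.Surjective φ) : IsIntegrable r A V' := by
  obtain ⟨D, hD, h⟩ := h.exists_finset
  refine isIntegrable_of_iSup_eq_top D hD ?_
  rw [eq_top_iff, ← LinearMap.range_eq_top.2 (show Function.Surjective φ.toLinearMap from hφ), LinearMap.range_eq_map, ← h,
    Submodule.map_iSup]
  refine iSup_le fun μ => ?_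
  rw [Submodule.map_iSup]
  refine iSup_le fun hμ => le_iSup₂_of_le μ hμ ?_
  rintro _ ⟨v, hv, rfl⟩ x
  change ⁅_, φ v⁆ = _ • φ v
  rw [← LieModuleHom.map_lie, hv x]
  exact map_smul φ.toLinearMap _ _

/-- Root vectors act nilpotently on integrable modules. -/
theorem IsIntegrable.exists_pow_eq_zero (hV : IsIntegrable r A V) {μ : Weight r} {u : V}
    (hu : u ∈ weightSubspace A V μ) (i j : Fin (r + 1)) (h : i ≠ j) :
    ∃ N, (LieModule.toEnd ℂ (Current r A) V ((1 : A) ⊗ₜ[ℂ] matE i j h) ^ N) u = 0 := by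
  obtain ⟨D, -, hD⟩ := hV.exists_finset
  let α : Weight r := diagWeight r i - diagWeight r j
  -- The powers move `u` through the weights `μ + Nα`. These are pairwise distinct because `α` takes
  -- the value `2` on `E_{ii} - E_{jj}`, so some of them lie outside the finite set `D`.
  have h1 : ∀ N : ℕ, (LieModule.toEnd ℂ (Current r A) V ((1 : A) ⊗ₜ[ℂ] matE i j h) ^ N) u ∈
      weightSubspace A V (μ + N • α) := by
    intro N
    induction N with
    | zero => simpa using hu
    | succ N ih =>
      intro x
      rw [pow_succ', Module.End.mul_apply, LieModule.toEnd_apply_apply, leibniz_lie,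
        LieAlgebra.ExtendScalars.bracket_tmul, ih x, lie_cartan_matE _ x.property, mul_one,
        TensorProduct.tmul_smul, lie_smul]
      refine (congrArg (· + _) (smul_lie _ _ _)).trans ?_
      rw [← add_smul]
      congr 1
      simp only [LinearMap.add_apply, LinearMap.smul_apply, succ_nsmul]
      change α x + _ = _
      ring
  have h2 : Function.Injective fun N : ℕ => μ + N • α := by
    intro N N' hN
    have h3 := congrArg (fun ν : Weight r => ν ⟨matH i j, matH_mem_cartan i j⟩) (add_left_cancel hN)
    simp only [LinearMap.smul_apply] at h3
    have h4 : α ⟨matH i j, matH_mem_cartan i j⟩ = 2 := by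
      change (matH i j).val i i - (matH i j).val j j = 2
      rw [matH_apply, matH_apply, if_pos rfl, if_neg h, if_neg h.symm, if_pos rfl]
      norm_num
    rw [h4, nsmul_eq_mul, nsmul_eq_mul] at h3
    exact Nat.cast_injective (mul_right_cancel₀ two_ne_zero h3)
  by_contra hcon
  push Not at hcon
  refine Set.infinite_range_of_injective h2 (D.finite_toSet.subset ?_)
  rintro _ ⟨N, rfl⟩
  by_contra hN
  refine hcon N ?_
  have := h1 N
  rwa [weightSubspace_eq_bot hD hN, Submodule.mem_bot] at this

end Integrable


/-! ### Relations satisfied by highest weight vectors of weight `n ω₁`. -/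

section HighestWeightSpace

variable {r : ℕ} (A : Type*) [CommRing A] [Algebra ℂ A] (W : Type*) [AddCommGroup W] [Module ℂ W]
  [LieRingModule (Current r A) W] [LieModule ℂ (Current r A) W]

/-- The vectors of weight `lam` killed by `n₊ ⊗ A`. -/
def highestWeightSpace (lam : Weight r) : Submodule ℂ W where
  carrier := {u | (∀ (x : nPlus r) (P : A), ⁅(P ⊗ₜ[ℂ] x.val : Current r A), u⁆ = 0) ∧
    u ∈ weightSubspace A W lam}
  add_mem' := fun {a b} ha hb =>
    ⟨fun x P => by rw [lie_add, ha.1, hb.1, add_zero], add_mem ha.2 hb.2⟩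
  zero_mem' := ⟨fun x P => lie_zero _, zero_mem _⟩
  smul_mem' := fun c a ha =>
    ⟨fun x P => by rw [lie_smul, ha.1, smul_zero], Submodule.smul_mem _ c ha.2⟩

variable {A W}

theorem lie_tmul_smul (P : A) (c : ℂ) (x : SL r) (u : W) :
    ⁅(P ⊗ₜ[ℂ] (c • x) : Current r A), u⁆ = c • ⁅(P ⊗ₜ[ℂ] x : Current r A), u⁆ :=
  (congrArg (⁅·, u⁆) (TensorProduct.tmul_smul c P x)).trans (smul_lie c (P ⊗ₜ[ℂ] x) u)

theorem matE_mem_nPlus {i j : Fin (r + 1)} (h : i < j) : matE i j h.ne ∈ nPlus r := fun a b hab => by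
  rw [matE_val, Matrix.single_apply, if_neg]
  rintro ⟨rfl, rfl⟩
  exact absurd hab (not_le.2 h)

theorem lie_cartan_nPlus {h x : SL r} (hh : h ∈ cartan r) (hx : x ∈ nPlus r) :
    ⁅h, x⁆ ∈ nPlus r := fun a b hab => by
  rw [LieAlgebra.SpecialLinear.sl_bracket]
  change (h.val * x.val) a b - (x.val * h.val) a b = 0
  rw [Matrix.mul_apply, Matrix.mul_apply, Finset.sum_eq_single a, Finset.sum_eq_single b,
    hx a b hab, mul_zero, zero_mul, sub_zero]
  · intro c _ hc; rw [hh c b hc, mul_zero]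
  · intro h; exact absurd (Finset.mem_univ _) h
  · intro c _ hc; rw [hh a c (Ne.symm hc), zero_mul]
  · intro h; exact absurd (Finset.mem_univ _) h

/-- In the global case `h ⊗ P` need not act on `u` by a scalar. What survives is that the whole
space of highest weight vectors is stable. -/
theorem lie_cartan_mem_highestWeightSpace {lam : Weight r} {u : W}
    (hu : u ∈ highestWeightSpace A W lam) {h : SL r} (hh : h ∈ cartan r) (P : A) :
    ⁅(P ⊗ₜ[ℂ] h : Current r A), u⁆ ∈ highestWeightSpace A W lam := by
  refine ⟨fun x Q => ?_, fun h' => ?_⟩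
  · rw [leibniz_lie, hu.1 x Q, lie_zero, add_zero, ← lie_skew,
      LieAlgebra.ExtendScalars.bracket_tmul, neg_lie,
      hu.1 ⟨_, lie_cartan_nPlus hh x.property⟩ (P * Q), neg_zero]
  · rw [leibniz_lie, LieAlgebra.ExtendScalars.bracket_tmul, lie_cartan_cartan h'.property hh,
      TensorProduct.tmul_zero, zero_lie, zero_add, hu.2 h', lie_smul]

omit [Module ℂ W] [LieModule ℂ (Current r A) W] in
theorem lie_cartan_comm (h h' : SL r) (hh : h ∈ cartan r) (hh' : h' ∈ cartan r) (P Q : A) (u : W) :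
    ⁅(P ⊗ₜ[ℂ] h : Current r A), ⁅(Q ⊗ₜ[ℂ] h' : Current r A), u⁆⁆ =
      ⁅(Q ⊗ₜ[ℂ] h' : Current r A), ⁅(P ⊗ₜ[ℂ] h : Current r A), u⁆⁆ := by
  rw [leibniz_lie, LieAlgebra.ExtendScalars.bracket_tmul, lie_cartan_cartan hh hh',
    TensorProduct.tmul_zero, zero_lie, zero_add]

variable [NeZero r] {n : ℕ}

theorem nsmul_fundamentalWeight_zero_apply (h : cartan r) :
    (n • fundamentalWeight r 0) h = n * h.val.val 0 0 := by
  rw [LinearMap.smul_apply, fundamentalWeight_zero_apply, nsmul_eq_mul]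

/-- Matrix units outside the first column kill the highest weight vectors. -/
theorem lie_matE_highest (hW : IsIntegrable r A W) {u : W}
    (hu : u ∈ highestWeightSpace A W (n • fundamentalWeight r 0)) (i j : Fin (r + 1)) (h : i ≠ j)
    (hj : j ≠ 0) (P : A) : ⁅(P ⊗ₜ[ℂ] matE i j h : Current r A), u⁆ = 0 ∧
      (i ≠ 0 → ⁅(P ⊗ₜ[ℂ] matH i j : Current r A), u⁆ = 0) := by
  suffices key : ∀ (i j : Fin (r + 1)) (h : i < j), i ≠ 0 → ∀ P : A,
      ⁅(P ⊗ₜ[ℂ] matE j i h.ne' : Current r A), u⁆ = 0 ∧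
      ⁅(P ⊗ₜ[ℂ] matH i j : Current r A), u⁆ = 0 by
    rcases lt_or_gt_of_ne h with hij | hij
    · exact ⟨hu.1 ⟨_, matE_mem_nPlus hij⟩ P, fun hi => (key i j hij hi P).2⟩
    · refine ⟨(key j i hij hj P).1, fun hi => ?_⟩
      have h1 : matH i j = -matH j i := Subtype.ext (by
        change _ = -(matH j i).val
        rw [matH_val, matH_val, neg_sub])
      rw [h1, TensorProduct.tmul_neg, neg_lie, (key j i hij hj P).2, neg_zero]
  intro i j hij hi P
  have hE : ∀ P : A, ⁅(P ⊗ₜ[ℂ] matE i j hij.ne : Current r A), u⁆ = 0 :=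
    fun P => hu.1 ⟨_, matE_mem_nPlus hij⟩ P
  -- The weight `n ω₁` vanishes on `E_{ii} - E_{jj}` when neither index is `0`, so `sl₂`-theory with
  -- `n = 0` kills `f ⊗ 1`. Bracketing with `e ⊗ P` then gives `h ⊗ P`, and bracketing `h ⊗ P` with
  -- `f ⊗ 1` gives `f ⊗ P`.
  have hf : ⁅((1 : A) ⊗ₜ[ℂ] matE j i hij.ne' : Current r A), u⁆ = 0 := by
    have h1 := sl2_pow_eq_zero (L := Current r A) (h := (1 : A) ⊗ₜ[ℂ] matH i j)
      (e := (1 : A) ⊗ₜ[ℂ] matE i j hij.ne) (f := (1 : A) ⊗ₜ[ℂ] matE j i hij.ne') (u := u) (n := 0)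
      (by rw [LieAlgebra.ExtendScalars.bracket_tmul, lie_matE_matE, mul_one])
      (by rw [LieAlgebra.ExtendScalars.bracket_tmul, lie_matH_matE, mul_one,
        two_nsmul, two_nsmul, TensorProduct.tmul_add])
      (by rw [LieAlgebra.ExtendScalars.bracket_tmul, lie_matH_matE_symm _ _ hij.ne, mul_one,
        two_nsmul, two_nsmul, TensorProduct.tmul_neg, TensorProduct.tmul_add])
      (by
        rw [hu.2 ⟨_, matH_mem_cartan i j⟩, nsmul_fundamentalWeight_zero_apply, matH_apply,
          if_neg hi.symm, if_neg (ne_of_gt (lt_of_le_of_lt (Fin.zero_le _) hij)).symm]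
        simp)
      (hE 1) (hW.exists_pow_eq_zero hu.2 _ _ _)
    simpa using h1
  have hH : ∀ P : A, ⁅(P ⊗ₜ[ℂ] matH i j : Current r A), u⁆ = 0 := fun P => by
    have h2 := leibniz_lie (P ⊗ₜ[ℂ] matE i j hij.ne : Current r A)
      ((1 : A) ⊗ₜ[ℂ] matE j i hij.ne' : Current r A) u
    rwa [hf, hE, lie_zero, lie_zero, add_zero, LieAlgebra.ExtendScalars.bracket_tmul,
      lie_matE_matE, mul_one, eq_comm] at h2
  refine ⟨?_, hH P⟩
  have h3 := leibniz_lie (P ⊗ₜ[ℂ] matH i j : Current r A)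
      ((1 : A) ⊗ₜ[ℂ] matE j i hij.ne' : Current r A) u
  rw [hf, hH, lie_zero, lie_zero, add_zero, LieAlgebra.ExtendScalars.bracket_tmul,
      lie_matH_matE_symm _ _ hij.ne, mul_one, two_nsmul, TensorProduct.tmul_neg,
      TensorProduct.tmul_add, neg_lie, add_lie, eq_comm, neg_eq_zero, ← two_nsmul,
      ← Nat.cast_smul_eq_nsmul ℂ] at h3
  exact (smul_eq_zero.1 h3).resolve_left (by norm_num)

/-- Matrices with zero first column kill the highest weight vectors. -/
theorem lie_highest_eq_zero (hW : IsIntegrable r A W) {u : W}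
    (hu : u ∈ highestWeightSpace A W (n • fundamentalWeight r 0)) (x : SL r)
    (hx : ∀ i, x.val i 0 = 0) (P : A) : ⁅(P ⊗ₜ[ℂ] x : Current r A), u⁆ = 0 := by
  let Y : Submodule ℂ (SL r) :=
    { carrier := {y | ⁅(P ⊗ₜ[ℂ] y : Current r A), u⁆ = 0}
      add_mem' := fun {a b} ha hb => by
        change ⁅(P ⊗ₜ[ℂ] (a + b) : Current r A), u⁆ = 0
        rw [TensorProduct.tmul_add, add_lie, ha, hb, add_zero]
      zero_mem' := by
        change ⁅(P ⊗ₜ[ℂ] 0 : Current r A), u⁆ = 0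
        rw [TensorProduct.tmul_zero, zero_lie]
      smul_mem' := fun c a ha => by
        change ⁅(P ⊗ₜ[ℂ] (c • a) : Current r A), u⁆ = 0
        rw [lie_tmul_smul, ha, smul_zero] }
  -- The reference index is the second one: it must differ from `0`, so that the differences `E_{ii}
  -- - E_{kk}` with `i ≠ 0` kill `u`.
  refine sl_mem_of_matE_mem x (Fin.succ 0) Y (fun i j h hij => ?_) (fun i h hi => ?_)
  · exact (lie_matE_highest hW hu i j h (fun hj => hij (by rw [hj]; exact hx i)) P).1
  · exact (lie_matE_highest hW hu i _ h (Fin.succ_ne_zero 0) P).2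
      (fun h0 => hi (by rw [h0]; exact hx 0))

theorem pow_lie_highest_eq_zero (hW : IsIntegrable r A W) {u : W}
    (hu : u ∈ highestWeightSpace A W (n • fundamentalWeight r 0)) :
    (LieModule.toEnd ℂ (Current r A) W
      ((1 : A) ⊗ₜ[ℂ] matE (Fin.succ 0) 0 (Fin.succ_ne_zero 0)) ^ (n + 1)) u = 0 := by
  have h01 : (0 : Fin (r + 1)) < Fin.succ 0 := Fin.succ_pos 0
  refine sl2_pow_eq_zero (L := Current r A) (h := (1 : A) ⊗ₜ[ℂ] matH 0 (Fin.succ 0))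
      (e := (1 : A) ⊗ₜ[ℂ] matE 0 (Fin.succ 0) h01.ne)
      (by rw [LieAlgebra.ExtendScalars.bracket_tmul, lie_matE_matE, mul_one])
      (by rw [LieAlgebra.ExtendScalars.bracket_tmul, lie_matH_matE, mul_one,
        two_nsmul, two_nsmul, TensorProduct.tmul_add])
      (by rw [LieAlgebra.ExtendScalars.bracket_tmul, lie_matH_matE_symm _ _ h01.ne, mul_one,
        two_nsmul, two_nsmul, TensorProduct.tmul_neg, TensorProduct.tmul_add])
      ?_ (hu.1 ⟨_, matE_mem_nPlus h01⟩ 1) (hW.exists_pow_eq_zero hu.2 _ _ _)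
  rw [hu.2 ⟨_, matH_mem_cartan 0 (Fin.succ 0)⟩, nsmul_fundamentalWeight_zero_apply, matH_apply,
    if_pos rfl, if_neg h01.ne]
  simp

end HighestWeightSpace

/-! ### The algebra `gl_{r+1} ⊗ A` and its first columns. -/

section Gl

variable (r : ℕ) (A : Type*) [CommRing A] [Algebra ℂ A]

/-- The algebra `gl_{r+1} ⊗ A`. -/
abbrev MatAlg := A ⊗[ℂ] Matrix (Fin (r + 1)) (Fin (r + 1)) ℂ

/-- The action of `gl_{r+1} ⊗ A` on `V_{r+1} ⊗ A`. -/
noncomputable def matAct : MatAlg r A →ₐ[ℂ] Module.End ℂ (LoopV r A) :=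
  Algebra.TensorProduct.lift (Algebra.lsmul ℂ ℂ (LoopV r A))
    ((Module.End.lTensorAlgHom ℂ _ A).comp (Matrix.toLinAlgEquiv' (R := ℂ)).toAlgHom)
    (fun _ _ => show Commute _ _ from TensorProduct.ext' fun _ _ => rfl)

variable {r A}

theorem matAct_tmul (a b : A) (x : Matrix (Fin (r + 1)) (Fin (r + 1)) ℂ) (v : Fin (r + 1) → ℂ) :
    matAct r A (a ⊗ₜ[ℂ] x) (b ⊗ₜ[ℂ] v) = (a * b) ⊗ₜ[ℂ] x.mulVec v := by
  rw [matAct]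
  exact congrArg (fun g : Module.End ℂ (LoopV r A) => g (b ⊗ₜ[ℂ] v))
    (Algebra.TensorProduct.lift_tmul _ _ _ a x)

variable (r A)

/-- The vectors `v_j ⊗ 1`. -/
noncomputable def loopVec (j : Fin (r + 1)) : LoopV r A := (1 : A) ⊗ₜ[ℂ] Pi.single j 1

/-- The matrix with first column `v` and zeros elsewhere. -/
noncomputable def colMat : (Fin (r + 1) → ℂ) →ₗ[ℂ] Matrix (Fin (r + 1)) (Fin (r + 1)) ℂ where
  toFun v := Matrix.vecMulVec v (Pi.single 0 1)
  map_add' v w := Matrix.add_vecMulVec v w _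
  map_smul' c v := Matrix.smul_vecMulVec c v _

/-- The embedding of `V_{r+1} ⊗ A` into `gl_{r+1} ⊗ A` as the first column. -/
noncomputable def firstColumn : LoopV r A →ₗ[ℂ] MatAlg r A := LinearMap.lTensor A (colMat r)

variable {r A}

theorem firstColumn_tmul (a : A) (v : Fin (r + 1) → ℂ) :
    firstColumn r A (a ⊗ₜ[ℂ] v) = a ⊗ₜ[ℂ] colMat r v := rfl

theorem firstColumn_matAct (x : MatAlg r A) (m : LoopV r A) :
    firstColumn r A (matAct r A x m) = x * firstColumn r A m := by
  induction x using TensorProduct.induction_on with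
  | zero => simp only [map_zero, LinearMap.zero_apply, zero_mul]
  | add x y hx hy => simp only [map_add, LinearMap.add_apply, add_mul, hx, hy]
  | tmul a x =>
    induction m using TensorProduct.induction_on with
    | zero => simp only [map_zero, mul_zero]
    | add m m' h h' => simp only [map_add, mul_add, h, h']
    | tmul b v =>
      rw [matAct_tmul, firstColumn_tmul, firstColumn_tmul, Algebra.TensorProduct.tmul_mul_tmul]
      congr 1
      exact (Matrix.mul_vecMulVec x v _).symm

theorem colMat_mulVec (v : Fin (r + 1) → ℂ) :
    (colMat r v).mulVec (Pi.single 0 1) = v := by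
  change (Matrix.vecMulVec v (Pi.single 0 1)).mulVec (Pi.single 0 1) = v
  rw [Matrix.vecMulVec_mulVec]
  simp

theorem matAct_firstColumn (m : LoopV r A) :
    matAct r A (firstColumn r A m) (loopVec r A 0) = m := by
  induction m using TensorProduct.induction_on with
  | zero => simp only [map_zero, LinearMap.zero_apply]
  | add m m' h h' => simp only [map_add, LinearMap.add_apply, h, h']
  | tmul b v => rw [firstColumn_tmul, loopVec, matAct_tmul, mul_one, colMat_mulVec]

/-- The inclusion of `sl_{r+1} ⊗ A` into `gl_{r+1} ⊗ A`. -/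
noncomputable def slIncl : Current r A →ₗ[ℂ] MatAlg r A :=
  LinearMap.lTensor A
    { toFun := fun y => y.val, map_add' := fun _ _ => rfl, map_smul' := fun _ _ => rfl }

theorem matAct_slIncl (x : Current r A) :
    matAct r A (slIncl x) = LieModule.toEnd ℂ (Current r A) (LoopV r A) x := by
  induction x using TensorProduct.induction_on with
  | zero => simp only [map_zero]
  | add x y hx hy => simp only [map_add, hx, hy]
  | tmul a x => exact TensorProduct.ext' fun b v => matAct_tmul a b x.val v

/-- The traceless part of a matrix. -/
noncomputable def tracelessPart (r : ℕ) : Matrix (Fin (r + 1)) (Fin (r + 1)) ℂ →ₗ[ℂ] SL r where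
  toFun x := ⟨x - (x.trace / (r + 1)) • 1, by
    change Matrix.trace (x - (x.trace / (r + 1)) • 1) = 0
    rw [Matrix.trace_sub, Matrix.trace_smul, Matrix.trace_one, Fintype.card_fin, smul_eq_mul,
      Nat.cast_succ, div_mul_cancel₀ _ (Nat.cast_add_one_ne_zero r), sub_self]⟩
  map_add' x y := Subtype.ext (by
    change x + y - ((x + y).trace / (r + 1)) • 1 =
      (x - (x.trace / (r + 1)) • 1) + (y - (y.trace / (r + 1)) • 1)
    rw [Matrix.trace_add, add_div, add_smul]
    abel)
  map_smul' c x := Subtype.ext (by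
    change c • x - ((c • x).trace / (r + 1)) • 1 = c • (x - (x.trace / (r + 1)) • 1)
    rw [Matrix.trace_smul, smul_sub, smul_smul, smul_eq_mul, mul_div_assoc])

theorem tracelessPart_val (x : Matrix (Fin (r + 1)) (Fin (r + 1)) ℂ) :
    (tracelessPart r x).val = x - (x.trace / (r + 1)) • 1 := rfl

theorem tracelessPart_coe (x : SL r) : tracelessPart r x.val = x := Subtype.ext (by
  have h : Matrix.trace x.val = 0 := x.property
  rw [tracelessPart_val, h, zero_div, zero_smul, sub_zero])

theorem lie_tracelessPart (x y : Matrix (Fin (r + 1)) (Fin (r + 1)) ℂ) :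
    ⁅tracelessPart r x, tracelessPart r y⁆ = tracelessPart r (x * y - y * x) := by
  refine Subtype.ext ?_
  rw [LieAlgebra.SpecialLinear.sl_bracket, tracelessPart_val, tracelessPart_val, tracelessPart_val,
    Matrix.trace_sub, Matrix.trace_mul_comm, sub_self, zero_div, zero_smul, sub_zero]
  generalize x.trace / ((r : ℂ) + 1) = a
  generalize y.trace / ((r : ℂ) + 1) = b
  simp only [sub_mul, mul_sub, smul_mul_assoc, mul_smul_comm, one_mul, mul_one, smul_sub, smul_smul,
    mul_comm b a]
  abel

end Gl

/-! ### Extending the action from `sl` to `gl`. -/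

section GlAction

variable {r : ℕ} [NeZero r] {A : Type*} [CommRing A] [Algebra ℂ A] {W : Type*} [AddCommGroup W]
  [Module ℂ W] [LieRingModule (Current r A) W] [LieModule ℂ (Current r A) W]

/-- The action of `h₁ ⊗ a` on the space of highest weight vectors. -/
noncomputable def corootAct (lam : Weight r) (a : A) :
    Module.End ℂ (highestWeightSpace A W lam) :=
  (LieModule.toEnd ℂ (Current r A) W (a ⊗ₜ[ℂ] matH 0 (Fin.succ 0))).restrict
    fun _ hu => lie_cartan_mem_highestWeightSpace hu (matH_mem_cartan _ _) a

/-- The action of `a ⊗ x ∈ gl_{r+1} ⊗ A` on maps from the highest weight vectors to `W`: the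
traceless part acts on `W`, and scalar matrices act through `h₁` on the highest weight vectors. -/
noncomputable def homActTmul (lam : Weight r) (a : A)
    (x : Matrix (Fin (r + 1)) (Fin (r + 1)) ℂ) :
    Module.End ℂ (highestWeightSpace A W lam →ₗ[ℂ] W) where
  toFun F := LieModule.toEnd ℂ (Current r A) W (a ⊗ₜ[ℂ] tracelessPart r x) ∘ₗ F +
    (x.trace / (r + 1)) • (F ∘ₗ corootAct lam a)
  map_add' F G := by
    rw [LinearMap.comp_add, LinearMap.add_comp, smul_add]
    abel
  map_smul' c F := by
    rw [LinearMap.comp_smul, LinearMap.smul_comp, RingHom.id_apply, smul_add, smul_comm]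

theorem homActTmul_apply (lam : Weight r) (a : A) (x : Matrix (Fin (r + 1)) (Fin (r + 1)) ℂ)
    (F : highestWeightSpace A W lam →ₗ[ℂ] W) (u : highestWeightSpace A W lam) :
    homActTmul lam a x F u = ⁅(a ⊗ₜ[ℂ] tracelessPart r x : Current r A), F u⁆ +
      (x.trace / (r + 1)) • F (corootAct lam a u) := rfl

/-- The action of `gl_{r+1} ⊗ A` on maps from the highest weight vectors to `W`. -/
noncomputable def homAct (lam : Weight r) :
    MatAlg r A →ₗ[ℂ] Module.End ℂ (highestWeightSpace A W lam →ₗ[ℂ] W) :=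
  TensorProduct.lift (LinearMap.mk₂ ℂ (homActTmul lam)
    (fun a b x => by
      ext F u
      simp only [homActTmul_apply, LinearMap.add_apply, TensorProduct.add_tmul, add_lie]
      have h : corootAct lam (a + b) u = corootAct lam a u + corootAct lam b u :=
        Subtype.ext (by
          change ⁅_, _⁆ = ⁅_, _⁆ + ⁅_, _⁆
          rw [TensorProduct.add_tmul, add_lie])
      rw [h, map_add, smul_add]
      abel)
    (fun c a x => by
      ext F u
      simp only [homActTmul_apply, LinearMap.smul_apply]
      have h : corootAct lam (c • a) u = c • corootAct lam a u :=
        Subtype.ext (smul_lie c (a ⊗ₜ[ℂ] matH 0 (Fin.succ 0) : Current r A) u.val)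
      rw [h, map_smul, smul_add, smul_comm c]
      congr 1
      exact smul_lie c (a ⊗ₜ[ℂ] tracelessPart r x : Current r A) (F u))
    (fun a x y => by
      ext F u
      simp only [homActTmul_apply, LinearMap.add_apply, map_add, TensorProduct.tmul_add, add_lie,
        Matrix.trace_add, add_div, add_smul]
      abel)
    (fun c a x => by
      ext F u
      simp only [homActTmul_apply, LinearMap.smul_apply, map_smul, lie_tmul_smul,
        Matrix.trace_smul, smul_eq_mul, smul_add, smul_smul, mul_div_assoc]))

theorem homAct_tmul (lam : Weight r) (a : A) (x : Matrix (Fin (r + 1)) (Fin (r + 1)) ℂ)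
    (F : highestWeightSpace A W lam →ₗ[ℂ] W) (u : highestWeightSpace A W lam) :
    homAct lam (a ⊗ₜ[ℂ] x) F u = ⁅(a ⊗ₜ[ℂ] tracelessPart r x : Current r A), F u⁆ +
      (x.trace / (r + 1)) • F (corootAct lam a u) := rfl

theorem homAct_slIncl (lam : Weight r) (x : Current r A)
    (F : highestWeightSpace A W lam →ₗ[ℂ] W) (u : highestWeightSpace A W lam) :
    homAct lam (slIncl x) F u = ⁅x, F u⁆ := by
  induction x using TensorProduct.induction_on with
  | zero => simp only [map_zero, LinearMap.zero_apply, zero_lie]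
  | add x y hx hy => simp only [map_add, LinearMap.add_apply, add_lie, hx, hy]
  | tmul a x =>
    have h : Matrix.trace x.val = 0 := x.property
    change homAct lam (a ⊗ₜ[ℂ] x.val) F u = _
    rw [homAct_tmul, tracelessPart_coe, h, zero_div, zero_smul, add_zero]

theorem homAct_commutator (lam : Weight r) (x y : MatAlg r A) :
    (homAct lam (x * y - y * x) : Module.End ℂ (highestWeightSpace A W lam →ₗ[ℂ] W)) =
      homAct lam x * homAct lam y - homAct lam y * homAct lam x := by
  induction x using TensorProduct.induction_on with
  | zero => simp only [map_zero, zero_mul, mul_zero, sub_self]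
  | add x x' hx hx' =>
    have h : (x + x') * y - y * (x + x') = (x * y - y * x) + (x' * y - y * x') := by noncomm_ring
    rw [h, map_add, hx, hx', map_add]
    noncomm_ring
  | tmul a x =>
    induction y using TensorProduct.induction_on with
    | zero => simp only [map_zero, zero_mul, mul_zero, sub_self]
    | add y y' hy hy' =>
      have h : (a ⊗ₜ[ℂ] x) * (y + y') - (y + y') * (a ⊗ₜ[ℂ] x) =
        ((a ⊗ₜ[ℂ] x) * y - y * (a ⊗ₜ[ℂ] x)) + ((a ⊗ₜ[ℂ] x) * y' - y' * (a ⊗ₜ[ℂ] x)) := by noncomm_ring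
      rw [h, map_add, hy, hy', map_add]
      noncomm_ring
    | tmul b y =>
      rw [Algebra.TensorProduct.tmul_mul_tmul, Algebra.TensorProduct.tmul_mul_tmul, mul_comm b a,
        ← TensorProduct.tmul_sub]
      ext F u
      rw [LinearMap.sub_apply, Module.End.mul_apply, Module.End.mul_apply, LinearMap.sub_apply,
        homAct_tmul, homAct_tmul, homAct_tmul, homAct_tmul, homAct_tmul, homAct_tmul, homAct_tmul,
        Matrix.trace_sub, Matrix.trace_mul_comm, sub_self, zero_div, zero_smul, add_zero,
        ← lie_tracelessPart, ← LieAlgebra.ExtendScalars.bracket_tmul, lie_lie]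
      -- Scalar matrices act by precomposition, so they commute with the traceless parts. They
      -- commute with one another because the operators `h₁ ⊗ a` do, and a commutator has trace
      -- zero.
      have hc : corootAct lam a (corootAct lam b u) = corootAct lam b (corootAct lam a u) :=
        Subtype.ext (lie_cartan_comm _ _ (matH_mem_cartan _ _) (matH_mem_cartan _ _) a b u.val)
      rw [hc]
      simp only [lie_add, lie_smul, smul_add]
      rw [smul_comm (x.trace / (r + 1) : ℂ)]
      abel

/-- Replacing the scalar part of `x` by the same multiple of `h₁ = E_{11} - E_{22}` leaves the first
column unchanged. This is the reason for letting scalars act through `h₁`. -/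
theorem tracelessPart_add_matH_apply (x : Matrix (Fin (r + 1)) (Fin (r + 1)) ℂ)
    (i : Fin (r + 1)) :
    (tracelessPart r x + (x.trace / (r + 1) : ℂ) • matH 0 (Fin.succ 0)).val i 0 = x i 0 := by
  change x i 0 - (x.trace / (r + 1)) * (1 : Matrix (Fin (r + 1)) (Fin (r + 1)) ℂ) i 0 +
    (x.trace / (r + 1)) * ((Matrix.single 0 0 1 : Matrix (Fin (r + 1)) (Fin (r + 1)) ℂ) i 0 -
      (Matrix.single (Fin.succ 0) (Fin.succ 0) 1 : Matrix (Fin (r + 1)) (Fin (r + 1)) ℂ) i 0) = x i 0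
  rw [Matrix.single_apply, Matrix.single_apply, Matrix.one_apply,
    if_neg (c := Fin.succ 0 = i ∧ _) (fun h => Fin.succ_ne_zero _ h.2)]
  simp only [and_true, eq_comm]
  ring

theorem homAct_subtype_apply (lam : Weight r) (a : A) (x : Matrix (Fin (r + 1)) (Fin (r + 1)) ℂ)
    (u : highestWeightSpace A W lam) :
    homAct lam (a ⊗ₜ[ℂ] x) (highestWeightSpace A W lam).subtype u =
      ⁅(a ⊗ₜ[ℂ] (tracelessPart r x + (x.trace / (r + 1) : ℂ) • matH 0 (Fin.succ 0)) :
        Current r A), u.val⁆ := by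
  rw [homAct_tmul, TensorProduct.tmul_add, add_lie, lie_tmul_smul]
  rfl

variable {n : ℕ} (hW : IsIntegrable r A W)

-- On the inclusion, `a ⊗ x` acts as an element of `sl ⊗ A` with the same first column, and matrices
-- with zero first column kill highest weight vectors. This provides hypothesis `hv` of
-- `exists_equivariant_map`.
include hW in
theorem homAct_subtype (x : MatAlg r A) :
    homAct (n • fundamentalWeight r 0) x
        (highestWeightSpace A W (n • fundamentalWeight r 0)).subtype =
      homAct (n • fundamentalWeight r 0)
        (firstColumn r A (matAct r A x (loopVec r A 0)))
        (highestWeightSpace A W (n • fundamentalWeight r 0)).subtype := by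
  induction x using TensorProduct.induction_on with
  | zero => simp only [map_zero, LinearMap.zero_apply]
  | add x x' hx hx' => simp only [map_add, LinearMap.add_apply, hx, hx']
  | tmul a x =>
    have h : firstColumn r A (matAct r A (a ⊗ₜ[ℂ] x) (loopVec r A 0)) =
        a ⊗ₜ[ℂ] colMat r (x.mulVec (Pi.single 0 1)) := by
      rw [loopVec, matAct_tmul, firstColumn_tmul, mul_one]
    rw [h]
    refine LinearMap.ext fun u => ?_
    rw [homAct_subtype_apply, homAct_subtype_apply, ← sub_eq_zero, ← sub_lie,
      ← TensorProduct.tmul_sub]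
    refine lie_highest_eq_zero hW u.property _ (fun i => ?_) a
    refine (congrArg₂ (· - ·) (tracelessPart_add_matH_apply x i)
      (tracelessPart_add_matH_apply _ i)).trans ?_
    change x i 0 - Matrix.vecMulVec _ _ i 0 = 0
    rw [Matrix.vecMulVec_apply]
    simp

end GlAction


/-! ### Matrix units acting on the vectors `a ⊗ v_j`. -/

section SingleVectors

attribute [local instance 100] LieRing.ofAssociativeRing

variable {r : ℕ} {A : Type*} [CommRing A] [Algebra ℂ A]

theorem colMat_single (i : Fin (r + 1)) : colMat r (Pi.single i 1) = Matrix.single i 0 1 := by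
  change Matrix.vecMulVec _ _ = _
  ext a b
  rw [Matrix.vecMulVec_apply, Matrix.single_apply]
  by_cases ha : i = a <;> by_cases hb : 0 = b <;> simp [ha, hb, eq_comm]

theorem single_mulVec_single (i j k : Fin (r + 1)) :
    (Matrix.single i j (1 : ℂ)).mulVec (Pi.single k 1) = if j = k then Pi.single i 1 else 0 := by
  rw [Matrix.mulVec_single_one]
  funext a
  rw [Matrix.col_apply, Matrix.single_apply]
  by_cases h : j = k
  · subst h
    simp [Pi.single_apply, eq_comm]
  · simp [h]

theorem matAct_single_loopVec (a : A) (i j k : Fin (r + 1)) :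
    matAct r A (a ⊗ₜ[ℂ] Matrix.single i j 1) (loopVec r A k) =
      if j = k then a ⊗ₜ[ℂ] Pi.single i 1 else 0 := by
  rw [loopVec, matAct_tmul, single_mulVec_single, mul_one]
  split_ifs
  · rfl
  · rw [TensorProduct.tmul_zero]

theorem firstColumn_loopVec (i : Fin (r + 1)) :
    firstColumn r A (loopVec r A i) = 1 ⊗ₜ[ℂ] Matrix.single i 0 1 := by
  rw [loopVec, firstColumn_tmul, colMat_single]

theorem span_tmul_single (r : ℕ) (A : Type*) [CommRing A] [Algebra ℂ A] :
    Submodule.span ℂ {m : LoopV r A | ∃ (a : A) (i : Fin (r + 1)), m = a ⊗ₜ[ℂ] Pi.single i 1} =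
      ⊤ := by
  rw [eq_top_iff]
  intro m _
  induction m using TensorProduct.induction_on with
  | zero => exact zero_mem _
  | add x y hx hy => exact add_mem (hx trivial) (hy trivial)
  | tmul a v =>
    have hv : v = ∑ i, v i • (Pi.single i 1 : Fin (r + 1) → ℂ) := by
      funext j
      simp [Finset.sum_apply, Pi.single_apply]
    rw [hv, TensorProduct.tmul_sum]
    refine Submodule.sum_mem _ fun i _ => ?_
    rw [TensorProduct.tmul_smul]
    exact Submodule.smul_mem _ _ (Submodule.subset_span ⟨a, i, rfl⟩)

theorem tensorAct_matAct_slIncl (k : ℕ) (x : Current r A) (t : ⨂[ℂ] _ : Fin k, LoopV r A) :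
    tensorAct k (matAct r A (slIncl x)) t = tensorAct k x t := by
  rw [matAct_slIncl]
  rfl

end SingleVectors

/-! ### The homomorphism out of the symmetric power. -/

section Homomorphism

attribute [local instance 100] LieRing.ofAssociativeRing

variable {r : ℕ} [NeZero r] {A : Type*} [CommRing A] [Algebra ℂ A] {W : Type*} [AddCommGroup W]
  [Module ℂ W] [LieRingModule (Current r A) W] [LieModule ℂ (Current r A) W] {n : ℕ}
  (hW : IsIntegrable r A W)

-- The first column `v₂ ⊗ 1` is the traceless matrix `E_{21}`, so the `gl`-action here is the
-- original one and `pow_lie_highest_eq_zero` applies.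
include hW in
theorem homAct_pow_subtype : (homAct (n • fundamentalWeight r 0)
      (firstColumn r A (loopVec r A (Fin.succ 0))) ^ (n + 1))
    (highestWeightSpace A W (n • fundamentalWeight r 0)).subtype = 0 := by
  have h10 : (Fin.succ 0 : Fin (r + 1)) ≠ 0 := Fin.succ_ne_zero 0
  have hfc : firstColumn r A (loopVec r A (Fin.succ 0)) =
      slIncl ((1 : A) ⊗ₜ[ℂ] matE (Fin.succ 0) 0 h10) := firstColumn_loopVec _
  have hpow : ∀ (k : ℕ) (u : highestWeightSpace A W (n • fundamentalWeight r 0)),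
      (homAct (n • fundamentalWeight r 0) (firstColumn r A (loopVec r A (Fin.succ 0))) ^ k)
        (highestWeightSpace A W (n • fundamentalWeight r 0)).subtype u =
      (LieModule.toEnd ℂ (Current r A) W ((1 : A) ⊗ₜ[ℂ] matE (Fin.succ 0) 0 h10) ^ k) u.val := by
    intro k u
    induction k with
    | zero => rfl
    | succ k ih =>
      rw [pow_succ', Module.End.mul_apply, hfc, homAct_slIncl, ← hfc, ih, pow_succ',
        Module.End.mul_apply, LieModule.toEnd_apply_apply]
  refine LinearMap.ext fun u => ?_
  rw [hpow]
  exact pow_lie_highest_eq_zero hW u.property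

theorem homAct_firstColumn_zero : homAct (n • fundamentalWeight r 0)
      (firstColumn r A (loopVec r A 0))
      (highestWeightSpace A W (n • fundamentalWeight r 0)).subtype =
    (n : ℂ) • (highestWeightSpace A W (n • fundamentalWeight r 0)).subtype := by
  refine LinearMap.ext fun u => ?_
  have key : ∀ y : SL r, y ∈ cartan r → y.val 0 0 = 1 →
      (⁅((1 : A) ⊗ₜ[ℂ] y : Current r A), u.val⁆ : W) = (n : ℂ) • u.val := fun y hy hy0 => by
    rw [u.property.2 ⟨y, hy⟩, nsmul_fundamentalWeight_zero_apply, hy0, mul_one]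
  rw [firstColumn_loopVec, homAct_subtype_apply]
  refine key _ (add_mem (fun i j hij => ?_) (Submodule.smul_mem _ _ (matH_mem_cartan _ _))) ?_
  · rw [tracelessPart_val, Matrix.sub_apply, Matrix.smul_apply, Matrix.one_apply_ne hij,
      Matrix.single_apply, if_neg (fun h => hij (h.1.symm.trans h.2)), smul_zero, sub_zero]
  · exact (tracelessPart_add_matH_apply _ 0).trans
      (by rw [Matrix.single_apply, if_pos ⟨rfl, rfl⟩])

/-- The matrices supported in the second column kill `v₁` and send `v₂` anywhere. A second column
exists because `r ≥ 1`. -/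
theorem span_matAct_loopVec : Submodule.span ℂ {m | ∃ x : MatAlg r A,
    matAct r A x (loopVec r A 0) = 0 ∧ matAct r A x (loopVec r A (Fin.succ 0)) = m} = ⊤ := by
  rw [eq_top_iff, ← span_tmul_single r A]
  refine Submodule.span_mono ?_
  rintro _ ⟨a, i, rfl⟩
  exact ⟨a ⊗ₜ[ℂ] Matrix.single i (Fin.succ 0) 1,
    by rw [matAct_single_loopVec, if_neg (Fin.succ_ne_zero 0)],
    by rw [matAct_single_loopVec, if_pos rfl]⟩

include hW in
/-- Every highest weight vector of weight `n ω₁` in an integrable module is the image of `v^{(n)}`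
under a homomorphism from `S^n(L_A(V_{r+1}))`. -/
theorem exists_symPower_hom {u : W}
    (hu : u ∈ highestWeightSpace A W (n • fundamentalWeight r 0)) :
    ∃ φ : SymPower n (LoopV r A) →ₗ⁅ℂ, Current r A⁆ W, φ (highestVector r A n) = u := by
  have h10 : (Fin.succ 0 : Fin (r + 1)) ≠ 0 := Fin.succ_ne_zero 0
  obtain ⟨T, hT, hT₀⟩ := exists_equivariant_map (m₁ := loopVec r A (Fin.succ 0)) (n := n)
    firstColumn_matAct matAct_firstColumn
    (homAct_commutator (n • fundamentalWeight r 0)) (homAct_subtype hW)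
    (by rw [firstColumn_loopVec, matAct_single_loopVec, if_neg h10.symm])
    (homAct_pow_subtype hW)
    span_matAct_loopVec
    homAct_firstColumn_zero
  -- Here `T` takes values in maps from the highest weight vectors to `W`. Evaluation at `u` is not
  -- `gl`-equivariant, but it is equivariant for `sl ⊗ A`, where no precomposition occurs.
  refine ⟨
    { toFun := fun t => T t.val ⟨u, hu⟩
      map_add' := fun t t' =>
        congrArg (fun F : _ →ₗ[ℂ] W => F ⟨u, hu⟩) (T.map_add t.val t'.val)
      map_smul' := fun c t =>
        congrArg (fun F : _ →ₗ[ℂ] W => F ⟨u, hu⟩) (T.map_smul c t.val)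
      map_lie' := fun {x t} => by
        have h2 := (hT (slIncl x) t.val).trans (congrArg T (tensorAct_matAct_slIncl n x t.val))
        exact (congrArg (fun F : _ →ₗ[ℂ] W => F ⟨u, hu⟩) h2).symm.trans (homAct_slIncl _ _ _ _) },
      ?_⟩
  exact congrArg (fun F : _ →ₗ[ℂ] W => F ⟨u, hu⟩) hT₀

end Homomorphism


/-! ### Maximal cyclic modules. -/

section CyclicModules

variable {L : Type*} [LieRing L] [LieAlgebra ℂ L]

/-- The elements satisfying `P` form a subalgebra through which `ι` factors, so by the universal
property the identity map factors through it too. -/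
theorem universalEnvelopingAlgebra_mem {P : UniversalEnvelopingAlgebra ℂ L → Prop}
    (hs : ∀ c : ℂ, P (algebraMap ℂ _ c)) (hι : ∀ x : L, P (UniversalEnvelopingAlgebra.ι ℂ x))
    (ha : ∀ u v, P u → P v → P (u + v)) (hm : ∀ u v, P u → P v → P (u * v))
    (u : UniversalEnvelopingAlgebra ℂ L) : P u := by
  let S : Subalgebra ℂ (UniversalEnvelopingAlgebra ℂ L) :=
    { carrier := {u | P u}
      add_mem' := fun h h' => ha _ _ h h'
      mul_mem' := fun h h' => hm _ _ h h'
      algebraMap_mem' := hs }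
  let g := UniversalEnvelopingAlgebra.ι ℂ (L := L)
  let _ : LieRing S := LieRing.ofAssociativeRing
  let _ : LieRing (UniversalEnvelopingAlgebra ℂ L) := LieRing.ofAssociativeRing
  let f : L →ₗ⁅ℂ⁆ S :=
    { toFun := fun x => ⟨g x, hι x⟩
      map_add' := fun x y => Subtype.ext (g.map_add x y)
      map_smul' := fun c x => Subtype.ext (g.map_smul c x)
      map_lie' := fun {x y} => Subtype.ext (g.map_lie x y) }
  have h : S.val.comp (UniversalEnvelopingAlgebra.lift ℂ f) = AlgHom.id ℂ _ := by
    refine UniversalEnvelopingAlgebra.hom_ext ℂ (LieHom.ext fun x => ?_)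
    change S.val (UniversalEnvelopingAlgebra.lift ℂ f (UniversalEnvelopingAlgebra.ι ℂ x)) = _
    rw [UniversalEnvelopingAlgebra.lift_ι_apply]
    rfl
  have h2 := congrArg (fun k : _ →ₐ[ℂ] _ => k u) h
  change (UniversalEnvelopingAlgebra.lift ℂ f u).val = u at h2
  rw [← h2]
  exact (UniversalEnvelopingAlgebra.lift ℂ f u).property

/-- Homomorphisms between cyclic quotients are linear over the enveloping algebra. -/
theorem lieModuleHom_smul {K K' : Submodule (UniversalEnvelopingAlgebra ℂ L)
      (UniversalEnvelopingAlgebra ℂ L)} (ψ : CyclicQuotient K →ₗ⁅ℂ, L⁆ CyclicQuotient K')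
    (u : UniversalEnvelopingAlgebra ℂ L) : ∀ m, ψ (u • m) = u • ψ m := by
  refine universalEnvelopingAlgebra_mem (P := fun u => ∀ m, ψ (u • m) = u • ψ m)
    (fun c m => ?_) (fun x m => ?_) (fun u v hu hv m => ?_)
    (fun u v hu hv m => ?_) u
  · rw [algebraMap_smul, algebraMap_smul]
    exact ψ.toLinearMap.map_smul c m
  · exact ψ.map_lie x m
  · rw [add_smul, add_smul, ← hu, ← hv]
    exact ψ.toLinearMap.map_add _ _
  · rw [mul_smul, mul_smul, hu, hv]

/-- If a cyclic module `S` has a defining property `p` and maps to every cyclic quotient with this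
property, then it is the largest one. -/
theorem exists_equiv_sInf {S : Type*} [AddCommGroup S] [Module ℂ S] [LieRingModule L S]
    [LieModule ℂ L S] (v : S) (hv : LieSubmodule.lieSpan ℂ L {v} = ⊤)
    (p : Submodule (UniversalEnvelopingAlgebra ℂ L) (UniversalEnvelopingAlgebra ℂ L) → Prop)
    (hp : ∀ K (e : CyclicQuotient K ≃ₗ⁅ℂ, L⁆ S), e (CyclicQuotient.gen K) = v → p K)
    (hφ : ∀ K, p K → ∃ φ : S →ₗ⁅ℂ, L⁆ CyclicQuotient K, φ v = CyclicQuotient.gen K) :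
    p (sInf {K | p K}) ∧ ∃ e : CyclicQuotient (sInf {K | p K}) ≃ₗ⁅ℂ, L⁆ S,
      e (CyclicQuotient.gen _) = v := by
  obtain ⟨K, e, he⟩ := exists_equiv_cyclicQuotient v hv
  have hK : sInf {K | p K} = K := by
    -- The left ideal `K` is the annihilator of `v`. A homomorphism sending `v` to the generator of
    -- `U / K'` forces this annihilator into `K'`.
    refine le_antisymm (sInf_le (hp K e he)) (le_sInf fun K' hK' u hu => ?_)
    obtain ⟨φ, hφ⟩ := hφ K' hK'
    have h1 := lieModuleHom_smul (φ.comp e.toLieModuleHom) u (CyclicQuotient.gen K)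
    have h2 : u • CyclicQuotient.gen K = 0 := by
      change Submodule.Quotient.mk (u * 1) = _
      rwa [mul_one, Submodule.Quotient.mk_eq_zero]
    have h3 : φ.comp e.toLieModuleHom (CyclicQuotient.gen K) = CyclicQuotient.gen K' := by
      change φ (e (CyclicQuotient.gen K)) = _
      rw [he, hφ]
    rw [h2, h3, map_zero] at h1
    have h4 : (Submodule.Quotient.mk (u * 1) : CyclicQuotient K') = 0 := h1.symm
    rwa [mul_one, Submodule.Quotient.mk_eq_zero] at h4
  rw [hK]
  exact ⟨hp K e he, e, he⟩

end CyclicModules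

/-! ### The symmetric power has the defining property of the global Weyl module. -/

section SymmetricPowerModule

variable (r : ℕ) (A : Type*) [CommRing A] [Algebra ℂ A] (n : ℕ)

theorem lie_loopVec {r : ℕ} {A : Type*} [CommRing A] [Algebra ℂ A] (a : A) (x : SL r)
    (j : Fin (r + 1)) :
    ⁅(a ⊗ₜ[ℂ] x : Current r A), loopVec r A j⁆ = a ⊗ₜ[ℂ] x.val.mulVec (Pi.single j 1) := by
  rw [loopVec, loopV_lie_tmul, mul_one]

theorem lie_cartan_tmul_single {r : ℕ} {A : Type*} [CommRing A] [Algebra ℂ A] (a b : A) (h : SL r)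
    (hh : h ∈ cartan r) (j : Fin (r + 1)) :
    ⁅(a ⊗ₜ[ℂ] h : Current r A), (b ⊗ₜ[ℂ] Pi.single j 1 : LoopV r A)⁆ =
      h.val j j • ((a * b) ⊗ₜ[ℂ] Pi.single j 1 : LoopV r A) := by
  rw [loopV_lie_tmul, ← TensorProduct.tmul_smul]
  congr 1
  rw [Matrix.mulVec_single_one]
  funext i
  rw [Matrix.col_apply, Pi.smul_apply]
  by_cases hi : i = j
  · subst hi; simp
  · rw [hh i j hi, Pi.single_eq_of_ne hi, smul_zero]

/-- Although `E_{11}` is not traceless, `h₁` has the same effect on `v₁`. -/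
theorem span_lie_loopVec [NeZero r] :
    Submodule.span ℂ (Set.range fun x : Current r A => ⁅x, loopVec r A 0⁆) = ⊤ := by
  rw [eq_top_iff, ← span_tmul_single r A]
  refine Submodule.span_mono ?_
  rintro _ ⟨a, i, rfl⟩
  by_cases hi : i = 0
  · subst hi
    refine ⟨a ⊗ₜ[ℂ] matH 0 (Fin.succ 0), ?_⟩
    change ⁅_, loopVec r A 0⁆ = _
    rw [loopVec, lie_cartan_tmul_single _ _ _ (matH_mem_cartan _ _), matH_apply, if_pos rfl,
      if_neg (Fin.succ_ne_zero 0).symm, sub_zero, one_smul, mul_one]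
  · refine ⟨a ⊗ₜ[ℂ] matE i 0 hi, ?_⟩
    change ⁅_, loopVec r A 0⁆ = _
    rw [lie_loopVec, matE_val, single_mulVec_single, if_pos rfl]

theorem mem_of_highestVector_mem [NeZero r]
    (N : LieSubmodule ℂ (Current r A) (SymPower n (LoopV r A))) (hN : highestVector r A n ∈ N)
    (t : SymPower n (LoopV r A)) : t ∈ N.toSubmodule := by
  refine symPower_mem_of_lie_mem (L := Current r A) N.toSubmodule (loopVec r A 0) ?_ ?_ ?_ t
  · exact hN
  · exact span_lie_loopVec r A
  · exact fun _ _ ht => N.lie_mem ht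

theorem lieSpan_highestVector [NeZero r] :
    LieSubmodule.lieSpan ℂ (Current r A) {highestVector r A n} = ⊤ :=
  eq_top_iff.2 fun t _ =>
    mem_of_highestVector_mem r A n _ (LieSubmodule.subset_lieSpan (Set.mem_singleton _)) t

variable {r A n}

theorem lie_highestVector {x : Current r A} {c : ℂ} (h : ⁅x, loopVec r A 0⁆ = c • loopVec r A 0) :
    ⁅x, highestVector r A n⁆ = ((n : ℂ) * c) • highestVector r A n :=
  Subtype.ext (tensorAct_tprod_const n x (loopVec r A 0) c h)

theorem lie_nPlus_highestVector (x : nPlus r) (P : A) :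
    ⁅(P ⊗ₜ[ℂ] x.val : Current r A), highestVector r A n⁆ = 0 := by
  rw [lie_highestVector (c := 0), mul_zero, zero_smul]
  rw [lie_loopVec, zero_smul, Matrix.mulVec_single_one]
  have : x.val.val.col 0 = 0 := funext fun i => x.property i 0 (Fin.zero_le _)
  rw [this, TensorProduct.tmul_zero]

theorem lie_cartan_highestVector (h : cartan r) :
    ⁅((1 : A) ⊗ₜ[ℂ] h.val : Current r A), highestVector r A n⁆ =
      ((n : ℂ) * h.val.val 0 0) • highestVector r A n := by
  refine lie_highestVector ?_
  rw [loopVec, lie_cartan_tmul_single _ _ _ h.property, mul_one]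

theorem coroot_val (i : Fin r) : (coroot r i).val = matH i.castSucc i.succ := rfl

theorem isIntegral_sum_diagWeight (f : Fin n → Fin (r + 1)) :
    IsIntegral (∑ i, diagWeight r (f i)) := fun k => by
  have h : ∀ j, ∃ m : ℤ, diagWeight r j (coroot r k) = m := fun j => by
    change ∃ m : ℤ, (matH k.castSucc k.succ).val j j = m
    rw [matH_apply]
    exact ⟨(if j = k.castSucc then 1 else 0) - (if j = k.succ then 1 else 0), by
      push_cast; rfl⟩
  choose m hm using h
  refine ⟨∑ i, m (f i), ?_⟩
  rw [LinearMap.sum_apply, Int.cast_sum]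
  exact Finset.sum_congr rfl fun i _ => hm (f i)

theorem exists_eq_sum_tmul_single (m : LoopV r A) :
    ∃ a : Fin (r + 1) → A, m = ∑ j, a j ⊗ₜ[ℂ] Pi.single j 1 := by
  induction m using TensorProduct.induction_on with
  | zero => exact ⟨0, by simp⟩
  | add x y hx hy =>
    obtain ⟨a, rfl⟩ := hx
    obtain ⟨b, rfl⟩ := hy
    exact ⟨a + b, by simp [TensorProduct.add_tmul, Finset.sum_add_distrib]⟩
  | tmul b v =>
    refine ⟨fun j => v j • b, ?_⟩
    have hv : v = ∑ i, v i • (Pi.single i 1 : Fin (r + 1) → ℂ) := by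
      funext j
      simp [Finset.sum_apply, Pi.single_apply]
    nth_rewrite 1 [hv]
    rw [TensorProduct.tmul_sum]
    exact Finset.sum_congr rfl fun i _ => by rw [TensorProduct.tmul_smul, TensorProduct.smul_tmul']

theorem symmetrize_mem_weightSubspace (f : Fin n → Fin (r + 1)) (a : Fin n → A) :
    symmetrize n (LoopV r A) (PiTensorProduct.tprod ℂ fun i => a i ⊗ₜ[ℂ] Pi.single (f i) 1) ∈
      weightSubspace A (SymPower n (LoopV r A)) (∑ i, diagWeight r (f i)) := fun h => by
  rw [lie_symmetrize, tensorAct_tprod, ← map_smul]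
  congr 1
  rw [LinearMap.sum_apply, Finset.sum_smul]
  refine Finset.sum_congr rfl fun i _ => ?_
  rw [lie_cartan_tmul_single _ _ _ h.property, one_mul, MultilinearMap.map_update_smul,
    Function.update_eq_self]
  rfl

variable (r A n)

theorem isIntegrable_symPower : IsIntegrable r A (SymPower n (LoopV r A)) := by
  classical
  refine isIntegrable_of_iSup_eq_top
    (Finset.univ.image fun f : Fin n → Fin (r + 1) => ∑ i, diagWeight r (f i)) ?_ ?_
  · intro μ hμ
    obtain ⟨f, -, rfl⟩ := Finset.mem_image.1 hμ
    exact isIntegral_sum_diagWeight f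
  · rw [eq_top_iff]
    intro t _
    -- Expanding each factor in the standard basis reduces to tensors of vectors `a ⊗ v_j`, whose
    -- symmetrizations are weight vectors. Only finitely many weights occur, one for each map `f` at
    -- most.
    refine symmetrize_mem _ (fun m => ?_) t
    choose a ha using fun i => exists_eq_sum_tmul_single (m i)
    rw [show m = fun i => ∑ j, a i j ⊗ₜ[ℂ] Pi.single j 1 from funext ha, MultilinearMap.map_sum,
      map_sum]
    refine Submodule.sum_mem _ fun f _ => ?_
    refine Submodule.mem_iSup_of_mem _ (Submodule.mem_iSup_of_mem
      (Finset.mem_image.2 ⟨f, Finset.mem_univ _, rfl⟩) ?_)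
    exact symmetrize_mem_weightSubspace f fun i => a i (f i)

variable {r A n}

theorem isGlobalGenerator_highestVector [NeZero r] :
    IsGlobalGenerator A (n • fundamentalWeight r 0) (highestVector r A n) where
  integrable := isIntegrable_symPower r A n
  generates := lieSpan_highestVector r A n
  nPlus_lie := lie_nPlus_highestVector
  cartan_lie h := by rw [lie_cartan_highestVector, nsmul_fundamentalWeight_zero_apply]

end SymmetricPowerModule

/-! ### Transport of the defining properties along isomorphisms. -/

section Transfer

variable {r : ℕ} {A : Type*} [CommRing A] [Algebra ℂ A] {V V' : Type*} [AddCommGroup V]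
  [Module ℂ V] [LieRingModule (Current r A) V] [LieModule ℂ (Current r A) V] [AddCommGroup V']
  [Module ℂ V'] [LieRingModule (Current r A) V'] [LieModule ℂ (Current r A) V']
  (e : V ≃ₗ⁅ℂ, Current r A⁆ V') {w : V} {v : V'} (he : e w = v)

include he

omit [LieModule ℂ (Current r A) V] [LieModule ℂ (Current r A) V'] in
theorem lie_eq_smul_of_equiv {x : Current r A} {c : ℂ} (h : ⁅x, v⁆ = c • v) : ⁅x, w⁆ = c • w := by
  apply e.injective
  have h1 : e ⁅x, w⁆ = ⁅x, e w⁆ := LieModuleHom.map_lie e.toLieModuleHom x w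
  have h2 : e (c • w) = c • e w := e.toLinearEquiv.map_smul c w
  rw [h1, h2, he, h]

theorem IsGlobalGenerator.of_equiv {lam : Weight r} (h : IsGlobalGenerator A lam v) :
    IsGlobalGenerator A lam w where
  integrable := h.integrable.of_equiv e
  generates := generates_of_equiv e he h.generates
  nPlus_lie x P := by
    rw [lie_eq_smul_of_equiv e he ((h.nPlus_lie x P).trans (zero_smul ℂ v).symm), zero_smul]
  cartan_lie x := lie_eq_smul_of_equiv e he (h.cartan_lie x)

theorem IsLocalGenerator.of_equiv {lam : Fin r → ℕ} {Z : WeightMultiset A lam}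
    (h : IsLocalGenerator Z v) : IsLocalGenerator Z w where
  integrable := h.integrable.of_equiv e
  generates := generates_of_equiv e he h.generates
  nPlus_lie x P := by
    rw [lie_eq_smul_of_equiv e he ((h.nPlus_lie x P).trans (zero_smul ℂ v).symm), zero_smul]
  coroot_lie i P := lie_eq_smul_of_equiv e he (h.coroot_lie i P)

end Transfer

/-! ### The global Weyl module. -/

section GlobalWeylModule

theorem globalWeyl_iso (r : ℕ) [NeZero r] (A : Type*) [CommRing A] [Algebra ℂ A] (n : ℕ) :
    IsGlobalGenerator A (n • fundamentalWeight r 0)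
        (globalWeylGen A (n • fundamentalWeight r 0)) ∧
      ∃ Φ : GlobalWeyl A (n • fundamentalWeight r 0) ≃ₗ⁅ℂ, Current r A⁆ SymPower n (LoopV r A),
        Φ (globalWeylGen A (n • fundamentalWeight r 0)) = highestVector r A n :=
  exists_equiv_sInf (highestVector r A n) (lieSpan_highestVector r A n)
    (fun K => IsGlobalGenerator A (n • fundamentalWeight r 0) (CyclicQuotient.gen K))
    (fun _ e he => isGlobalGenerator_highestVector.of_equiv e he)
    (fun _ hK => exists_symPower_hom hK.integrable ⟨hK.nPlus_lie, hK.cartan_lie⟩)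

end GlobalWeylModule


/-! ### The local Weyl module. -/

section LocalWeylModule

variable {r : ℕ} [NeZero r] {A : Type*} [CommRing A] [Algebra ℂ A] {n : ℕ}

theorem evalAt_powerSum (z : Fin n → Point A) (a : A) :
    evalAt n z (powerSum n a).val = ∑ i, z i a := by
  change evalAt n z (∑ i : Fin n, PiTensorProduct.tprod ℂ (Function.update (1 : Fin n → A) i a)) = _
  rw [map_sum]
  refine Finset.sum_congr rfl fun i _ => ?_
  rw [evalAt_tprod, Finset.prod_eq_single i]
  · rw [Function.update_self]
  · intro j _ hj
    rw [Function.update_of_ne hj, Pi.one_apply, map_one]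
  · intro h; exact absurd (Finset.mem_univ i) h

/-- Since `h₁ v = v`, the Leibniz rule inserts `a` into one factor at a time. This identity connects
the Cartan action with that of `S^n(A)`. -/
theorem lie_coroot_highestVector (a : A) :
    ⁅(a ⊗ₜ[ℂ] matH 0 (Fin.succ 0) : Current r A), highestVector r A n⁆ =
      powerSum n a • highestVector r A n := by
  refine Subtype.ext ?_
  rw [symPower_lie_val, symPower_smul_val]
  change tensorAct n _ (PiTensorProduct.tprod ℂ fun _ => loopVec r A 0) =
    factorAct n (∑ i : Fin n, PiTensorProduct.tprod ℂ (Function.update (1 : Fin n → A) i a))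
      (PiTensorProduct.tprod ℂ fun _ => loopVec r A 0)
  rw [tensorAct_tprod, map_sum, LinearMap.sum_apply]
  refine Finset.sum_congr rfl fun i _ => ?_
  rw [factorAct_tprod]
  congr 1
  funext j
  by_cases h : j = i
  · subst h
    rw [Function.update_self, Function.update_self, loopVec,
      lie_cartan_tmul_single _ _ _ (matH_mem_cartan _ _), matH_apply, if_pos rfl,
      if_neg (Fin.succ_ne_zero 0).symm, sub_zero, one_smul, TensorProduct.smul_tmul', smul_eq_mul]
  · rw [Function.update_of_ne h, Function.update_of_ne h, Pi.one_apply, one_smul]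

theorem lie_coroot_highestVector_of_ne {i : Fin r} (hi : i ≠ 0) (a : A) :
    ⁅(a ⊗ₜ[ℂ] (coroot r i).val : Current r A), highestVector r A n⁆ = 0 := by
  rw [lie_highestVector (c := 0), mul_zero, zero_smul]
  rw [loopVec, lie_cartan_tmul_single _ _ _ (coroot r i).property, coroot_val, matH_apply,
    if_neg, if_neg (Fin.succ_ne_zero i).symm, sub_zero, zero_smul, zero_smul]
  intro h
  refine hi (Fin.castSucc_injective r ?_)
  rw [← h, Fin.castSucc_zero]

theorem coroot_zero_val : (coroot r 0).val = matH 0 (Fin.succ 0) := by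
  rw [coroot_val, Fin.castSucc_zero]

theorem sum_firstPoints (Z : WeightMultiset A (nOmegaOne r n)) (P : A) :
    ∑ j, Z 0 j P = ∑ k, firstPoints Z k P :=
  (Fintype.sum_equiv (finCongr (Pi.single_eq_same (M := fun _ : Fin r => ℕ) 0 n).symm) _ _
    fun _ => rfl).symm

theorem sum_points_of_ne (Z : WeightMultiset A (nOmegaOne r n)) {i : Fin r} (hi : i ≠ 0) (P : A) :
    ∑ j, Z i j P = 0 := by
  have h : nOmegaOne r n i = 0 := Pi.single_eq_of_ne hi _
  have : IsEmpty (Fin (nOmegaOne r n i)) := by rw [h]; infer_instance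
  exact Fintype.sum_empty _

/-- A power sum minus its value at the points lies in the vanishing ideal; this yields the local
relation for `h₁ ⊗ P` in the quotient. -/
theorem powerSum_smul_sub_mem (Z : WeightMultiset A (nOmegaOne r n)) (P : A) :
    powerSum n P • highestVector r A n - (∑ k, firstPoints Z k P) • highestVector r A n ∈
      idealSubmodule r n (multisetIdeal Z) := by
  have h : powerSum n P • highestVector r A n - (∑ k, firstPoints Z k P) • highestVector r A n =
      (powerSum n P - (∑ k, firstPoints Z k P) • (1 : SymAlgebra n A)) • highestVector r A n := by
    rw [sub_smul, smul_assoc, one_smul]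
  rw [h]
  change _ ∈ multisetIdeal Z • (⊤ : Submodule (SymAlgebra n A) (SymPower n (LoopV r A)))
  refine Submodule.smul_mem_smul ?_ Submodule.mem_top
  change (evalAt n (firstPoints Z)) ((powerSum n P).val - (∑ k, firstPoints Z k P) • 1) = 0
  rw [map_sub, evalAt_powerSum, map_smul, map_one, smul_eq_mul, mul_one, sub_self]

theorem isLocalGenerator_highestVector (Z : WeightMultiset A (nOmegaOne r n)) :
    IsLocalGenerator Z (LieSubmodule.Quotient.mk (highestVector r A n) :
      SymPower n (LoopV r A) ⧸ idealSubmodule r n (multisetIdeal Z)) := by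
  let π := LieSubmodule.Quotient.mk' (idealSubmodule r n (multisetIdeal Z))
  have hπ : Function.Surjective π := LieSubmodule.Quotient.surjective_mk' _
  have hlie : ∀ x : Current r A, ⁅x, π (highestVector r A n)⁆ = π ⁅x, highestVector r A n⁆ :=
    fun x => (π.map_lie x _).symm
  refine ⟨(isIntegrable_symPower r A n).of_surjective π hπ, ?_, fun x P => ?_, fun i P => ?_⟩
  · rw [eq_top_iff]
    intro m _
    obtain ⟨t, rfl⟩ := hπ m
    have h1 : (⊤ : LieSubmodule ℂ (Current r A) (SymPower n (LoopV r A))) ≤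
        (LieSubmodule.lieSpan ℂ (Current r A) {π (highestVector r A n)}).comap π := by
      rw [← lieSpan_highestVector r A n, LieSubmodule.lieSpan_le, Set.singleton_subset_iff]
      exact LieSubmodule.subset_lieSpan rfl
    exact h1 (LieSubmodule.mem_top t)
  · refine (hlie _).trans ?_
    rw [lie_nPlus_highestVector, map_zero]
  · refine (hlie _).trans ?_
    by_cases hi : i = 0
    · subst hi
      rw [coroot_zero_val, lie_coroot_highestVector, sum_firstPoints]
      have h2 : π (powerSum n P • highestVector r A n -
          (∑ k, firstPoints Z k P) • highestVector r A n) = 0 :=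
        (LieSubmodule.Quotient.mk_eq_zero').2 (powerSum_smul_sub_mem Z P)
      rw [map_sub, sub_eq_zero] at h2
      exact h2.trans (π.toLinearMap.map_smul _ _)
    · rw [lie_coroot_highestVector_of_ne hi, map_zero, sum_points_of_ne Z hi, zero_smul]

variable {W : Type*} [AddCommGroup W] [Module ℂ W] [LieRingModule (Current r A) W]
  [LieModule ℂ (Current r A) W] {Z : WeightMultiset A (nOmegaOne r n)} {w : W}

theorem IsLocalGenerator.lie_coroot_zero (hw : IsLocalGenerator Z w) (P : A) :
    ⁅(P ⊗ₜ[ℂ] matH 0 (Fin.succ 0) : Current r A), w⁆ = (∑ k, firstPoints Z k P) • w := by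
  rw [← coroot_zero_val, hw.coroot_lie, sum_firstPoints]

/-- With `P = 1` the eigenvalue of `h_i` counts the points of index `i`, giving `n` for the first
coroot and `0` for the others. Coroots span the Cartan subalgebra, so the weight is `n ω₁`. -/
theorem IsLocalGenerator.mem_highestWeightSpace (hw : IsLocalGenerator Z w) :
    w ∈ highestWeightSpace A W (n • fundamentalWeight r 0) := by
  refine ⟨hw.nPlus_lie, fun h => ?_⟩
  rw [nsmul_fundamentalWeight_zero_apply]
  let Y : Submodule ℂ (SL r) :=
    { carrier := {x | ⁅((1 : A) ⊗ₜ[ℂ] x : Current r A), w⁆ = ((n : ℂ) * x.val 0 0) • w}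
      add_mem' := fun {a b} ha hb => by
        change ⁅((1 : A) ⊗ₜ[ℂ] (a + b) : Current r A), w⁆ = ((n : ℂ) * (a.val 0 0 + b.val 0 0)) • w
        rw [TensorProduct.tmul_add, add_lie, ha, hb, mul_add, add_smul]
      zero_mem' := by
        change ⁅((1 : A) ⊗ₜ[ℂ] (0 : SL r) : Current r A), w⁆ = ((n : ℂ) * 0) • w
        rw [TensorProduct.tmul_zero, zero_lie, mul_zero, zero_smul]
      smul_mem' := fun c a ha => by
        change ⁅((1 : A) ⊗ₜ[ℂ] (c • a) : Current r A), w⁆ = ((n : ℂ) * (c * a.val 0 0)) • w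
        rw [lie_tmul_smul, ha, smul_smul, mul_left_comm] }
  have h1 : ∀ i : Fin r, matH i.castSucc i.succ ∈ Y := fun i => by
    change ⁅((1 : A) ⊗ₜ[ℂ] (coroot r i).val : Current r A), w⁆ = _
    rw [hw.coroot_lie, matH_apply, if_neg (Fin.succ_ne_zero i).symm, sub_zero]
    by_cases hi : i = 0
    · subst hi
      rw [sum_firstPoints, if_pos (Fin.castSucc_zero).symm]
      simp
    · rw [sum_points_of_ne Z hi, if_neg, mul_zero]
      intro h
      refine hi (Fin.castSucc_injective r ?_)
      rw [← h, Fin.castSucc_zero]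
  have h2 : ∀ i : Fin (r + 1), matH 0 i ∈ Y := fun i => by
    induction i using Fin.induction with
    | zero =>
      have : matH 0 0 = (0 : SL r) := Subtype.ext (sub_self _)
      rw [this]; exact Y.zero_mem
    | succ i ih =>
      have : matH 0 i.succ = matH 0 i.castSucc + matH i.castSucc i.succ :=
        (LieAlgebra.SpecialLinear.singleSubSingle_add_singleSubSingle _ _ _ _).symm
      rw [this]; exact Y.add_mem ih (h1 i)
  refine sl_mem_of_matE_mem h.val 0 Y (fun i j hij hne => absurd (h.property i j hij) hne)
    fun i _ _ => ?_
  have : matH i 0 = -matH 0 i := Subtype.ext (by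
    change _ = -(matH 0 i).val
    rw [matH_val, matH_val, neg_sub])
  rw [this]
  exact Y.neg_mem (h2 i)

/-- For power sums this is the defining relation of `w` pulled back through
`lie_coroot_highestVector`, and power sums generate `S^n(A)`. -/
theorem IsLocalGenerator.map_smul_highestVector (hw : IsLocalGenerator Z w)
    (φ : SymPower n (LoopV r A) →ₗ⁅ℂ, Current r A⁆ W) (hφ : φ (highestVector r A n) = w)
    (R : SymAlgebra n A) :
    φ (R • highestVector r A n) = evalAt n (firstPoints Z) R.val • w := by
  let Y : Submodule ℂ (SymAlgebra n A) :=
    { carrier := {R | φ (R • highestVector r A n) = evalAt n (firstPoints Z) R.val • w}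
      add_mem' := fun {a b} ha hb => by
        change φ ((a + b) • highestVector r A n) = evalAt n (firstPoints Z) (a.val + b.val) • w
        rw [add_smul, map_add, map_add, ha, hb, add_smul]
      zero_mem' := by
        change φ ((0 : SymAlgebra n A) • highestVector r A n) = evalAt n (firstPoints Z) 0 • w
        rw [zero_smul, map_zero, map_zero, zero_smul]
      smul_mem' := fun c a ha => by
        change φ ((c • a) • highestVector r A n) = evalAt n (firstPoints Z) (c • a.val) • w
        have ha' : φ (a • highestVector r A n) = evalAt n (firstPoints Z) a.val • w := ha
        rw [smul_assoc, map_smul, ha', map_smul, smul_assoc] }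
  refine symAlgebra_mem_of_powerSum_mul_mem n Y ?_ (fun a t ht => ?_) R
  · change φ ((1 : SymAlgebra n A) • highestVector r A n) = evalAt n (firstPoints Z) 1 • w
    rw [one_smul, map_one, one_smul, hφ]
  · change φ ((powerSum n a * t) • highestVector r A n) =
      evalAt n (firstPoints Z) ((powerSum n a).val * t.val) • w
    have ht' : φ (t • highestVector r A n) = evalAt n (firstPoints Z) t.val • w := ht
    -- Commuting the power sum next to `v^{(n)}` turns it into `h₁ ⊗ a`, which then moves out past
    -- `t` and through `φ`.
    rw [mul_comm, mul_smul, ← lie_coroot_highestVector, ← lie_smul_symAlgebra,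
      LieModuleHom.map_lie, ht', lie_smul, hw.lie_coroot_zero, smul_smul, map_mul, evalAt_powerSum,
      mul_comm]

/-- For `R` in the ideal, the vectors `u` with `φ (R • u) = 0` form a `sl ⊗ A`-submodule because the
two actions commute. It contains the generator `v^{(n)}`, as `R` vanishes at the points. -/
theorem IsLocalGenerator.map_eq_zero (hw : IsLocalGenerator Z w)
    (φ : SymPower n (LoopV r A) →ₗ⁅ℂ, Current r A⁆ W) (hφ : φ (highestVector r A n) = w)
    {t : SymPower n (LoopV r A)} (ht : t ∈ idealSubmodule r n (multisetIdeal Z)) : φ t = 0 := by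
  change t ∈ multisetIdeal Z • (⊤ : Submodule (SymAlgebra n A) (SymPower n (LoopV r A))) at ht
  induction ht using Submodule.smul_induction_on' with
  | add p hp q hq ihp ihq => rw [map_add, ihp, ihq, add_zero]
  | smul R hR u hu =>
    let Y : Submodule ℂ (SymPower n (LoopV r A)) :=
      { carrier := {u | φ (R • u) = 0}
        add_mem' := fun {a b} ha hb => by
          change φ (R • (a + b)) = 0
          rw [smul_add, map_add, ha, hb, add_zero]
        zero_mem' := by
          change φ (R • (0 : SymPower n (LoopV r A))) = 0
          rw [smul_zero, map_zero]
        smul_mem' := fun c a ha => by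
          change φ (R • c • a) = 0
          have h : R • c • a = c • R • a := Subtype.ext (map_smul (factorAct n R.val) c a.val)
          rw [h]
          refine (φ.toLinearMap.map_smul c _).trans ?_
          exact (congrArg (c • ·) ha).trans (smul_zero c) }
    suffices h : u ∈ Y from h
    refine symPower_mem_of_lie_mem (L := Current r A) Y (loopVec r A 0) ?_ ?_ ?_ u
    · change φ (R • highestVector r A n) = 0
      have h : evalAt n (firstPoints Z) R.val = 0 := hR
      rw [hw.map_smul_highestVector φ hφ, h, zero_smul]
    · exact span_lie_loopVec r A
    · intro x s hs
      change φ (R • ⁅x, s⁆) = 0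
      have hs' : φ (R • s) = 0 := hs
      rw [← lie_smul_symAlgebra, LieModuleHom.map_lie, hs', lie_zero]

theorem IsLocalGenerator.exists_hom (hw : IsLocalGenerator Z w) :
    ∃ φ : (SymPower n (LoopV r A) ⧸ idealSubmodule r n (multisetIdeal Z)) →ₗ⁅ℂ, Current r A⁆ W,
      φ (LieSubmodule.Quotient.mk (highestVector r A n)) = w := by
  obtain ⟨φ, hφ⟩ := exists_symPower_hom hw.integrable hw.mem_highestWeightSpace
  let f := (idealSubmodule r n (multisetIdeal Z)).toSubmodule.liftQ φ.toLinearMap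
    fun t ht => hw.map_eq_zero φ hφ ht
  refine ⟨{ f with map_lie' := fun {x m} => ?_ }, hφ⟩
  obtain ⟨t, rfl⟩ := LieSubmodule.Quotient.surjective_mk' _ m
  exact φ.map_lie x t

theorem localWeyl_iso (Z : WeightMultiset A (nOmegaOne r n)) :
    IsLocalGenerator Z (localWeylGen Z) ∧
      ∃ Ψ : LocalWeyl Z ≃ₗ⁅ℂ, Current r A⁆
          (SymPower n (LoopV r A) ⧸ idealSubmodule r n (multisetIdeal Z)),
        Ψ (localWeylGen Z) = LieSubmodule.Quotient.mk (highestVector r A n) :=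
  exists_equiv_sInf _ (isLocalGenerator_highestVector Z).generates
    (fun K => IsLocalGenerator Z (CyclicQuotient.gen K))
    (fun _ e he => (isLocalGenerator_highestVector Z).of_equiv e he)
    (fun _ hK => hK.exists_hom)

end LocalWeylModule

end WeylSym

theorem mainTheorem5 (r : ℕ) [NeZero r] (A : Type*) [CommRing A] [Algebra ℂ A] (n : ℕ) :
    (IsGlobalGenerator A (n • fundamentalWeight r 0)
        (globalWeylGen A (n • fundamentalWeight r 0)) ∧
      ∃ Φ : GlobalWeyl A (n • fundamentalWeight r 0) ≃ₗ⁅ℂ, Current r A⁆ SymPower n (LoopV r A),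
        Φ (globalWeylGen A (n • fundamentalWeight r 0)) = highestVector r A n) ∧
    ∀ Z : WeightMultiset A (nOmegaOne r n),
      IsLocalGenerator Z (localWeylGen Z) ∧
      ∃ Ψ : LocalWeyl Z ≃ₗ⁅ℂ, Current r A⁆
          (SymPower n (LoopV r A) ⧸ idealSubmodule r n (multisetIdeal Z)),
        Ψ (localWeylGen Z) = LieSubmodule.Quotient.mk (highestVector r A n) :=
  ⟨globalWeyl_iso r A n, localWeyl_iso⟩
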